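/- For $f\in L^2(\mathbb R;\mathbb C)$ let $\hat f(\xi)=\int_{\mathbb R} e^{-ix\xi}f(x)\,dx$ (extended to $L^2$ by Plancherel). Let $a>0$, $0\le\gamma<\frac14$ and $t_0\ge 1$, and set $$\|f\|_{X_{t_0}^\gamma}=\frac{1}{t_0^{1/4}}\|f\|_{L^2}+\frac{t_0^\gamma}{\sqrt{t_0}}\big\||\xi|^{2\gamma}\hat f(\xi)\big\|_{L^\infty(\xi^2\le 1)},$$ $$\|g\|_{Y_{t_0}^\gamma}=\sup_{t\ge t_0}\Big(\frac{1}{t_0^{1/4}}\|g(t)\|_{L^2}+\Big(\frac{t_0}{t}\Big)^{a^2}\frac{t_0^\gamma}{\sqrt{t_0}}\big\||\xi|^{2\gamma}\hat g(t,\xi)\big\|_{L^\infty(\xi^2\le 1)}\Big),$$ and let $X_{t_0}^\gamma$, $Y_{t_0}^\gamma$ be the spaces of functions for which these norms are finite. For either choice of sign consider the linear equation $$iu_t+u_{xx}\pm\frac{a^2}{t^{1\pm 2ia^2}}\,\overline{u}=0,\qquad t>t_0,\qquad(\ast)$$ whose solutions are functions $u\in C([t_0,\infty);L^2)$ satisfying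 $(\ast)$ in the sense of distributions in $x$. **Proposition.** Let $t_0\ge1$ and let $u(t_0)\in X_{t_0}^\gamma$. Then there is a unique global solution $u\in Y_{t_0}^\gamma$ of $(\ast)$ with initial data $u(t_0)$ at time $t_0$, and it scatters in $L^2$. More precisely, there exists $u_+\in L^2$ such that, for every $0<\delta<\frac14-\gamma$ and every $t\ge t_0$, $$\big\|u(t)-e^{i(t-t_0)\partial_x^2}u_+\big\|_{L^2}\le C(a,\delta)\,\frac{(1+\log t_0)\,t_0^{\frac12-(\gamma+\delta)}}{t^{\frac14-(\gamma+\delta)}}\,\|u(t_0)\|_{X_{t_0}^\gamma},$$ where $C(a,\delta)$ depends only on $a$ and $\delta$; in particular $\|u(t)-e^{i(t-t_0)\partial_x^2}u_+\|_{L^2}\to0$ as $t\to\infty$. -/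

import Mathlib

open MeasureTheory FourierTransform Set Filter Topology
open scoped ENNReal SchwartzMap

/-- The space `L²(ℝ; ℂ)`. -/
abbrev L2 : Type := Lp (α := ℝ) ℂ 2

/-- The Fourier transform in the angular convention, `f̂(ξ) = ∫ e^{-ixξ} f(x) dx`, extended to `L²`.
Mathlib's `𝓕` is the Plancherel extension of `∫ e^{-2πixk} f(x) dx`, so `f̂(ξ) = (𝓕 f)(ξ / 2π)`. -/
noncomputable def angularFourier (f : L2) (ξ : ℝ) : ℂ :=
  (𝓕 f : L2) (ξ / (2 * Real.pi))

/-- `‖ |ξ|^{2γ} f̂(ξ) ‖_{L^∞(ξ² ≤ 1)}` (an essential supremum, possibly infinite). -/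
noncomputable def lowFreqNorm (γ : ℝ) (f : L2) : ℝ≥0∞ :=
  eLpNorm (fun ξ : ℝ => ((|ξ| ^ (2 * γ) : ℝ) : ℂ) * angularFourier f ξ) ∞
    (volume.restrict {ξ : ℝ | ξ ^ 2 ≤ 1})

/-- The norm of `X_{t₀}^γ`, with value `∞` outside the space:
`t₀^{-1/4} ‖f‖_{L²} + t₀^γ / √t₀ · ‖ |ξ|^{2γ} f̂ ‖_{L^∞(ξ² ≤ 1)}`. -/
noncomputable def normX (γ t₀ : ℝ) (f : L2) : ℝ≥0∞ :=
  ENNReal.ofReal (1 / t₀ ^ (1 / 4 : ℝ) * ‖f‖)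
    + ENNReal.ofReal (t₀ ^ γ / √t₀) * lowFreqNorm γ f

/-- The norm of `Y_{t₀}^γ`, with value `∞` outside the space. -/
noncomputable def normY (a γ t₀ : ℝ) (g : ℝ → L2) : ℝ≥0∞ :=
  ⨆ (t : ℝ) (_ : t₀ ≤ t),
    (ENNReal.ofReal (1 / t₀ ^ (1 / 4 : ℝ) * ‖g t‖)
      + ENNReal.ofReal ((t₀ / t) ^ (a ^ 2) * (t₀ ^ γ / √t₀)) * lowFreqNorm γ (g t))

/-- `u ∈ C([t₀, ∞); L²)` solves `i u_t + u_xx + σ a² t^{-(1 + 2 i σ a²)} ū = 0` for `t > t₀`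
in the sense of (tempered) distributions in `x`: for every Schwartz function `φ`,
`i d/dt ∫ u φ + ∫ u φ'' + σ a² t^{-(1 + 2 i σ a²)} ∫ ū φ = 0`. The signs `±` are `σ = ±1`. -/
structure IsLinSolution (σ a t₀ : ℝ) (u : ℝ → L2) : Prop where
  continuousOn : ContinuousOn u (Ici t₀)
  equation : ∀ φ : 𝓢(ℝ, ℂ), ∀ t : ℝ, t₀ < t → ∃ d : ℂ,
    HasDerivAt (fun s : ℝ => ∫ x : ℝ, u s x * φ x) d t ∧
    Complex.I * d + (∫ x : ℝ, u t x * iteratedDeriv 2 φ x)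
      + σ * ((a : ℂ) ^ 2 / (t : ℂ) ^ (1 + 2 * Complex.I * σ * (a : ℂ) ^ 2))
        * (∫ x : ℝ, (starRingEnd ℂ) (u t x) * φ x) = 0

/-- `u` is a global solution, on `[t₀, ∞)`, in `Y_{t₀}^γ`, with value `f` at time `t₀`. -/
structure IsGlobalSolutionY (σ a γ t₀ : ℝ) (f : L2) (u : ℝ → L2) : Prop where
  solution : IsLinSolution σ a t₀ u
  initial : u t₀ = f
  memY : normY a γ t₀ u < ∞

theorem memLp_schrodinger_phase (τ : ℝ) (g : L2) :
    MemLp (fun k : ℝ => Complex.exp (((-(τ * (2 * Real.pi * k) ^ 2) : ℝ) : ℂ) * Complex.I) * g k)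
      2 volume := by
  refine (Lp.memLp g).of_le (AEStronglyMeasurable.mul ?_ (Lp.aestronglyMeasurable g)) ?_
  · exact (by fun_prop : Continuous fun k : ℝ =>
      Complex.exp (((-(τ * (2 * Real.pi * k) ^ 2) : ℝ) : ℂ) * Complex.I)).aestronglyMeasurable
  · refine Eventually.of_forall fun k => ?_
    rw [norm_mul, Complex.norm_exp_ofReal_mul_I, one_mul]

/-- The free Schrödinger propagator `e^{iτ∂ₓ²}` on `L²`: the Fourier multiplier `e^{-iτξ²}`,
where `ξ = 2πk` in terms of the frequency variable `k` of `𝓕`. -/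
noncomputable def freeSchrodinger (τ : ℝ) (f : L2) : L2 :=
  𝓕⁻ ((memLp_schrodinger_phase τ (𝓕 f : L2)).toLp _ : L2)

/-!
The conjugate-linear equation decouples over pairs of frequencies `±ξ` and can there be reduced to
a single ordinary differential equation. With `κ = ± a²` and `u = t^{-iκ} (p + iq)`, where `p` and
`q` are real-valued, the equation becomes `p_t = -q_xx`, `q_t = p_xx + (2κ/t) p`. On the Fourier
side, in the variable `s = ξ² t`, this is the Coulomb system `P' = Q`, `Q' = (-1 + 2κ/s) P`
(`IsCoulombPair`), which no longer depends on `ξ`. Its solutions give coefficients `m`, `n`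
(`modeDirect`, `modeConj`) such that `û(t, ξ) = m f̂(ξ) + n conj (f̂(-ξ))`.

Three estimates for the Coulomb system carry the argument. The energy `P² + Q²` grows at most like
`(s/s₀)^(2|κ|)` (`IsCoulombPair.sq_add_sq_le_rpow`); this is the growth that the weight
`(t₀/t)^(a²)` in the norm of `Y_{t₀}^γ` allows. For `s ≥ 1 + 4|κ|` the modified energy
`(1 - 2κ/s) P² + Q²` stays bounded, and for small `s` the weighted energy `P² + s^(2ε) Q²` costs only
`s₀^(-2ε)`; together they bound the modes for all times by an arbitrarily small negative power of
`ξ² t₀` (`IsCoulombPair.exists_sq_add_sq_le`). Finally the profiles `e^{iξ²(t-t₀)} m` and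
`e^{iξ²(t-t₀)} n` are driven by terms of size `1/t` that oscillate with frequency about `2ξ²`, so one
integration by parts (`norm_sub_le_of_oscillating`) shows that they converge, with an error
`O(min(1, 1/(ξ²t)))` times that small power.

The `L²` norm of the error is then computed by Plancherel. At high frequency it is
`O(‖f‖ / t)`. At low frequency `|f̂|² ≤ B² ξ^(-4γ)`, and rescaling by `√t` leaves an integral that
converges because `γ + δ < 1/4` (`profileWeight_mul_sq_le`,
`exists_norm_modeProfile_sub_le`). No logarithm is lost, so the factor `1 + log t₀` is only used
through `1 + log t₀ ≥ 1`.

Testing the weak equation against Fourier transforms of Schwartz functions turns it into the same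
equation on the Fourier side (`isLinSolution_iff`). For uniqueness, a smooth cutoff to bounded
frequencies commutes with the equation and makes its generator bounded, so a Gronwall iteration
applies (`IsFourierSolution.eq_zero`).
-/

/-! ### Gronwall inequalities with an explicit integrating factor -/

theorem le_mul_exp_of_deriv_le {E E' G g : ℝ → ℝ} {a b : ℝ} (hab : a ≤ b)
    (hEc : ContinuousOn E (Icc a b)) (hGc : ContinuousOn G (Icc a b))
    (hE : ∀ x ∈ Ioo a b, HasDerivAt E (E' x) x) (hG : ∀ x ∈ Ioo a b, HasDerivAt G (g x) x)
    (h : ∀ x ∈ Ioo a b, E' x ≤ g x * E x) : E b ≤ E a * Real.exp (G b - G a) := by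
  have hd : ∀ x ∈ Ioo a b, HasDerivAt (fun x => E x * Real.exp (-G x))
      (E' x * Real.exp (-G x) + E x * (Real.exp (-G x) * -g x)) x := fun x hx =>
    (hE x hx).mul (hG x hx).neg.exp
  have hanti : AntitoneOn (fun x => E x * Real.exp (-G x)) (Icc a b) := by
    refine antitoneOn_of_deriv_nonpos (convex_Icc a b)
      (hEc.mul (Real.continuous_exp.comp_continuousOn hGc.neg)) ?_ ?_
    · rw [interior_Icc]
      exact fun x hx => (hd x hx).differentiableAt.differentiableWithinAt
    · rw [interior_Icc]
      intro x hx
      rw [(hd x hx).deriv]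
      have := mul_nonneg (sub_nonneg.2 (h x hx)) (Real.exp_pos (-G x)).le
      linarith
  have h1 := hanti (left_mem_Icc.2 hab) (right_mem_Icc.2 hab) hab
  simp only at h1
  have h2 := mul_le_mul_of_nonneg_right h1 (Real.exp_pos (G b)).le
  rw [mul_assoc, ← Real.exp_add, neg_add_cancel, Real.exp_zero, mul_one, mul_assoc,
    ← Real.exp_add] at h2
  rwa [show G b - G a = -G a + G b by ring]

theorem le_mul_exp_of_le_deriv {E E' G g : ℝ → ℝ} {a b : ℝ} (hab : a ≤ b)
    (hEc : ContinuousOn E (Icc a b)) (hGc : ContinuousOn G (Icc a b))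
    (hE : ∀ x ∈ Ioo a b, HasDerivAt E (E' x) x) (hG : ∀ x ∈ Ioo a b, HasDerivAt G (g x) x)
    (h : ∀ x ∈ Ioo a b, -(g x * E x) ≤ E' x) : E a ≤ E b * Real.exp (G b - G a) := by
  have hm : ∀ x ∈ Ioo (-b) (-a), -x ∈ Ioo a b := fun x hx =>
    ⟨by linarith [hx.2], by linarith [hx.1]⟩
  have hmc : MapsTo (fun x : ℝ => -x) (Icc (-b) (-a)) (Icc a b) := fun x hx =>
    ⟨by linarith [hx.2], by linarith [hx.1]⟩
  have key := le_mul_exp_of_deriv_le (E := fun x => E (-x)) (E' := fun x => -E' (-x))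
    (G := fun x => -G (-x)) (g := fun x => g (-x)) (neg_le_neg hab)
    (hEc.comp continuous_neg.continuousOn hmc) (hGc.comp continuous_neg.continuousOn hmc).neg
    (fun x hx => ?_) (fun x hx => ?_) (fun x hx => by linarith [h _ (hm x hx)])
  · simpa [sub_eq_add_neg, add_comm] using key
  · have := (hE _ (hm x hx)).comp x (hasDerivAt_neg x)
    rw [mul_neg_one] at this
    exact this
  · have := ((hG _ (hm x hx)).comp x (hasDerivAt_neg x)).neg
    rw [mul_neg_one, neg_neg] at this
    exact this

/-! ### The scale-invariant system `P' = Q`, `Q' = (-1 + 2κ/s) P` -/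

/-- `(P, Q)` solves `P' = Q`, `Q' = (-1 + 2κ/s) P` on `(0, ∞)`, that is, `P` is a Coulomb wave
function with parameter `κ`. -/
structure IsCoulombPair (κ : ℝ) (P Q : ℝ → ℝ) : Prop where
  hasDerivAt_fst : ∀ s : ℝ, 0 < s → HasDerivAt P (Q s) s
  hasDerivAt_snd : ∀ s : ℝ, 0 < s → HasDerivAt Q ((-1 + 2 * κ / s) * P s) s

/-- The truncation of a real number to `[-R, R]`. -/
noncomputable def truncate (R x : ℝ) : ℝ := max (-R) (min R x)

theorem abs_truncate_le {R : ℝ} (hR : 0 ≤ R) (x : ℝ) : |truncate R x| ≤ R := by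
  unfold truncate
  rw [abs_le]
  exact ⟨le_max_left _ _, max_le (by linarith) (min_le_left _ _)⟩

theorem truncate_of_abs_le {R x : ℝ} (h : |x| ≤ R) : truncate R x = x := by
  unfold truncate
  rw [abs_le] at h
  rw [min_eq_right h.2, max_eq_right h.1]

theorem abs_truncate_le_abs {R : ℝ} (hR : 0 ≤ R) (x : ℝ) : |truncate R x| ≤ |x| := by
  rcases le_total |x| R with h | h
  · rw [truncate_of_abs_le h]
  · exact (abs_truncate_le hR x).trans h

theorem abs_truncate_sub_le (R x y : ℝ) : |truncate R x - truncate R y| ≤ |x - y| := by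
  unfold truncate
  refine (abs_max_sub_max_le_max _ _ _ _).trans ?_
  simp only [sub_self, abs_zero]
  refine max_le (abs_nonneg _) ((abs_min_sub_min_le_max _ _ _ _).trans ?_)
  simp

/-- Existence on a compact interval. The field is truncated, so that the Picard-Lindelöf theorem
applies on the whole interval; an energy estimate shows that the truncation is never felt. -/
theorem exists_coulombPair_Icc (κ p₀ q₀ : ℝ) {N : ℝ} (hN : 1 < N) :
    ∃ x : ℝ → ℝ × ℝ, x 1 = (p₀, q₀) ∧ ∀ s ∈ Ioo (1 / N) N,
      HasDerivAt x ((x s).2, (-1 + 2 * κ / s) * (x s).1) s := by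
  have hN0 : 0 < N := by linarith
  have hN1 : 1 / N < 1 := by rw [div_lt_one hN0]; exact hN
  have hiN : 0 < 1 / N := by positivity
  set K : ℝ := 1 + 2 * |κ| * N with hK
  have hK1 : 1 ≤ K := by rw [hK]; nlinarith [abs_nonneg κ]
  have hcoef : ∀ s ∈ Icc (1 / N) N, |-1 + 2 * κ / s| ≤ K := by
    intro s hs
    have hs0 : 0 < s := hiN.trans_le hs.1
    refine (abs_add_le _ _).trans ?_
    rw [hK, abs_div, abs_mul, abs_of_pos hs0]
    simp only [abs_neg, abs_one, Nat.abs_ofNat]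
    have : 2 * |κ| / s ≤ 2 * |κ| * N := by
      rw [div_eq_mul_inv]
      gcongr
      rw [inv_le_comm₀ hs0 hN0, ← one_div]
      exact hs.1
    linarith
  set R : ℝ := Real.sqrt ((p₀ ^ 2 + q₀ ^ 2) * Real.exp ((1 + K) * N)) with hR
  have hR0 : 0 ≤ R := Real.sqrt_nonneg _
  set f : ℝ → ℝ × ℝ → ℝ × ℝ := fun s x => (truncate R x.2, (-1 + 2 * κ / s) * truncate R x.1)
    with hf
  have hcont : ContinuousOn (fun s : ℝ => -1 + 2 * κ / s) (Icc (1 / N) N) := by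
    refine continuousOn_const.add (continuousOn_const.div continuousOn_id fun s hs => ?_)
    exact (hiN.trans_le hs.1).ne'
  let KK : NNReal := ⟨K, by linarith⟩
  let LL : NNReal := ⟨K * R, by positivity⟩
  let aa : NNReal := ⟨K * R * max (N - 1) (1 - 1 / N), by
    have : 0 ≤ max (N - 1) (1 - 1 / N) := le_max_of_le_left (by linarith)
    positivity⟩
  have hPL : IsPicardLindelof f (⟨1, hN1.le, hN.le⟩ : Icc (1 / N) N) (p₀, q₀) aa 0 LL KK := by
    refine ⟨fun s hs => ?_, fun x _ => ?_, fun s hs x _ => ?_, ?_⟩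
    · refine LipschitzWith.lipschitzOnWith (LipschitzWith.of_dist_le_mul fun x y => ?_)
      have hb := hcoef s hs
      have h1 := abs_truncate_sub_le R x.1 y.1
      have h2 := abs_truncate_sub_le R x.2 y.2
      have e1 : |x.1 - y.1| ≤ dist x y := by
        rw [Prod.dist_eq, ← Real.dist_eq]; exact le_max_left _ _
      have e2 : |x.2 - y.2| ≤ dist x y := by
        rw [Prod.dist_eq, ← Real.dist_eq]; exact le_max_right _ _
      change dist (f s x) (f s y) ≤ K * dist x y
      rw [Prod.dist_eq]
      refine max_le ?_ ?_
      · simp only [hf, Real.dist_eq]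
        nlinarith [dist_nonneg (x := x) (y := y)]
      · simp only [hf, Real.dist_eq, ← mul_sub, abs_mul]
        exact mul_le_mul hb (h1.trans e1) (abs_nonneg _) (by linarith)
    · exact continuousOn_const.prodMk (hcont.mul continuousOn_const)
    · change ‖f s x‖ ≤ K * R
      rw [Prod.norm_def]
      refine max_le ?_ ?_
      · simp only [hf, Real.norm_eq_abs]
        nlinarith [abs_truncate_le hR0 x.2]
      · simp only [hf, Real.norm_eq_abs, abs_mul]
        exact mul_le_mul (hcoef s hs) (abs_truncate_le hR0 _) (abs_nonneg _) (by linarith)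
    · change K * R * max (N - 1) (1 - 1 / N) ≤ K * R * max (N - 1) (1 - 1 / N) - 0
      simp
  obtain ⟨x, hx1, hx⟩ := hPL.exists_eq_forall_mem_Icc_hasDerivWithinAt₀
  have hxd : ∀ s ∈ Ioo (1 / N) N, HasDerivAt x (f s (x s)) s := fun s hs =>
    (hx s (Ioo_subset_Icc_self hs)).hasDerivAt (Icc_mem_nhds hs.1 hs.2)
  have hxc : ContinuousOn x (Icc (1 / N) N) := fun s hs => (hx s hs).continuousWithinAt
  set E : ℝ → ℝ := fun s => (x s).1 ^ 2 + (x s).2 ^ 2 with hE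
  set E' : ℝ → ℝ := fun s => 2 * (x s).1 * truncate R (x s).2 +
    2 * (x s).2 * ((-1 + 2 * κ / s) * truncate R (x s).1) with hE'
  have hEc : ContinuousOn E (Icc (1 / N) N) :=
    ((continuous_fst.comp_continuousOn hxc).pow 2).add
      ((continuous_snd.comp_continuousOn hxc).pow 2)
  have hEd : ∀ s ∈ Ioo (1 / N) N, HasDerivAt E (E' s) s := by
    intro s hs
    have h1 : HasDerivAt (fun s => (x s).1) (f s (x s)).1 s := (hxd s hs).fst
    have h2 : HasDerivAt (fun s => (x s).2) (f s (x s)).2 s := (hxd s hs).snd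
    refine ((h1.pow 2).add (h2.pow 2)).congr_deriv ?_
    simp [hE', hf]
  have hEabs : ∀ s ∈ Ioo (1 / N) N, |E' s| ≤ (1 + K) * E s := by
    intro s hs
    have hb := hcoef s (Ioo_subset_Icc_self hs)
    have h1 := abs_truncate_le_abs hR0 (x s).1
    have h2 := abs_truncate_le_abs hR0 (x s).2
    have t1 : |2 * (x s).1 * truncate R (x s).2| ≤ 2 * (|(x s).1| * |(x s).2|) := by
      rw [abs_mul, abs_mul, abs_two, mul_assoc]
      gcongr
    have t2 : |2 * (x s).2 * ((-1 + 2 * κ / s) * truncate R (x s).1)|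
        ≤ K * (2 * (|(x s).1| * |(x s).2|)) := by
      rw [abs_mul, abs_mul, abs_mul, abs_two]
      have := mul_le_mul hb h1 (abs_nonneg _) (by linarith)
      have h3 := mul_le_mul_of_nonneg_left this (show 0 ≤ 2 * |(x s).2| by positivity)
      linarith
    have t3 : 2 * (|(x s).1| * |(x s).2|) ≤ E s := by
      have := two_mul_le_add_sq |(x s).1| |(x s).2|
      simp only [sq_abs] at this
      simp only [hE]; linarith
    have := abs_add_le (2 * (x s).1 * truncate R (x s).2)
      (2 * (x s).2 * ((-1 + 2 * κ / s) * truncate R (x s).1))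
    simp only [hE']
    nlinarith
  have hE1 : E 1 = p₀ ^ 2 + q₀ ^ 2 := by simp [hE, hx1]
  have hG : ∀ s : ℝ, HasDerivAt (fun s => (1 + K) * s) (1 + K) s := fun s => by
    simpa using (hasDerivAt_id s).const_mul (1 + K)
  have hGc : Continuous fun s : ℝ => (1 + K) * s := by fun_prop
  have hEN : ∀ s ∈ Icc (1 / N) N, E s ≤ R ^ 2 := by
    intro s hs
    have hs0 : 0 < s := hiN.trans_le hs.1
    rw [hR, Real.sq_sqrt (by positivity)]
    rcases le_total 1 s with h | h
    · have := le_mul_exp_of_deriv_le (E := E) (E' := E') h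
        (hEc.mono (Icc_subset_Icc hN1.le hs.2)) hGc.continuousOn
        (fun y hy => hEd y ⟨hN1.trans hy.1, hy.2.trans_le hs.2⟩) (fun y _ => hG y)
        (fun y hy => (le_abs_self _).trans (hEabs y ⟨hN1.trans hy.1, hy.2.trans_le hs.2⟩))
      rw [hE1] at this
      refine this.trans ?_
      gcongr
      nlinarith [hs.2]
    · have := le_mul_exp_of_le_deriv (E := E) (E' := E') h
        (hEc.mono (Icc_subset_Icc hs.1 hN.le)) hGc.continuousOn
        (fun y hy => hEd y ⟨hs.1.trans_lt hy.1, hy.2.trans hN⟩) (fun y _ => hG y)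
        (fun y hy => (abs_le.1 (hEabs y ⟨hs.1.trans_lt hy.1, hy.2.trans hN⟩)).1)
      rw [hE1] at this
      refine this.trans ?_
      gcongr
      nlinarith [hs.1]
  refine ⟨x, hx1, fun s hs => ?_⟩
  have hEs := hEN s (Ioo_subset_Icc_self hs)
  have b1 : |(x s).1| ≤ R := abs_le_of_sq_le_sq (by
    simp only [hE] at hEs; nlinarith [sq_nonneg (x s).2]) hR0
  have b2 : |(x s).2| ≤ R := abs_le_of_sq_le_sq (by
    simp only [hE] at hEs; nlinarith [sq_nonneg (x s).1]) hR0
  have := hxd s hs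
  simpa only [hf, truncate_of_abs_le b1, truncate_of_abs_le b2] using this

theorem coulombPair_eqOn (κ : ℝ) {N : ℝ} (hN : 1 < N) {x y : ℝ → ℝ × ℝ}
    (hx : ∀ s ∈ Ioo (1 / N) N, HasDerivAt x ((x s).2, (-1 + 2 * κ / s) * (x s).1) s)
    (hy : ∀ s ∈ Ioo (1 / N) N, HasDerivAt y ((y s).2, (-1 + 2 * κ / s) * (y s).1) s)
    (h : x 1 = y 1) : EqOn x y (Ioo (1 / N) N) := by
  have hN0 : 0 < N := by linarith
  have hN1 : 1 / N < 1 := by rw [div_lt_one hN0]; exact hN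
  have hiN : 0 < 1 / N := by positivity
  let K : NNReal := ⟨1 + 2 * |κ| * N, by positivity⟩
  refine ODE_solution_unique_of_mem_Ioo (K := K) (s := fun _ => univ)
    (v := fun s x => (x.2, (-1 + 2 * κ / s) * x.1)) (fun s hs => ?_) ⟨hN1, hN⟩
    (fun s hs => ⟨hx s hs, mem_univ _⟩) (fun s hs => ⟨hy s hs, mem_univ _⟩) h
  refine LipschitzWith.lipschitzOnWith (LipschitzWith.of_dist_le_mul fun x y => ?_)
  have hs0 : 0 < s := hiN.trans hs.1
  have hc : |-1 + 2 * κ / s| ≤ 1 + 2 * |κ| * N := by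
    refine (abs_add_le _ _).trans ?_
    rw [abs_div, abs_mul, abs_of_pos hs0]
    simp only [abs_neg, abs_one, Nat.abs_ofNat]
    have : 2 * |κ| / s ≤ 2 * |κ| * N := by
      rw [div_eq_mul_inv]
      gcongr
      rw [inv_le_comm₀ hs0 hN0, ← one_div]
      exact hs.1.le
    linarith
  have e1 : |x.1 - y.1| ≤ dist x y := by
    rw [Prod.dist_eq, ← Real.dist_eq]; exact le_max_left _ _
  have e2 : |x.2 - y.2| ≤ dist x y := by
    rw [Prod.dist_eq, ← Real.dist_eq]; exact le_max_right _ _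
  change dist _ _ ≤ (1 + 2 * |κ| * N) * dist x y
  rw [Prod.dist_eq]
  refine max_le ?_ ?_
  · simp only [Real.dist_eq]
    have : 0 ≤ 2 * |κ| * N * dist x y := by positivity
    linarith
  · simp only [Real.dist_eq, ← mul_sub, abs_mul]
    exact mul_le_mul hc e1 (abs_nonneg _) (by positivity)

/-- The solutions on the intervals `(1/(n+2), n+2)` agree where they overlap, by uniqueness, and glue
to a solution on `(0, ∞)`. -/
theorem exists_isCoulombPair (κ p₀ q₀ : ℝ) :
    ∃ P Q : ℝ → ℝ, IsCoulombPair κ P Q ∧ P 1 = p₀ ∧ Q 1 = q₀ := by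
  have hN : ∀ n : ℕ, (1 : ℝ) < n + 2 := fun n => by
    have : (0 : ℝ) ≤ n := n.cast_nonneg
    linarith
  choose x hx1 hx using fun n : ℕ => exists_coulombPair_Icc κ p₀ q₀ (hN n)
  have hsub : ∀ {m n : ℕ}, m ≤ n →
      Ioo (1 / ((m : ℝ) + 2)) (m + 2) ⊆ Ioo (1 / ((n : ℝ) + 2)) (n + 2) := by
    intro m n hmn
    have : (m : ℝ) ≤ n := by exact_mod_cast hmn
    exact Ioo_subset_Ioo (by gcongr) (by linarith)
  have hagree : ∀ {m n : ℕ}, m ≤ n → EqOn (x m) (x n) (Ioo (1 / ((m : ℝ) + 2)) (m + 2)) :=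
    fun {m n} hmn => coulombPair_eqOn κ (hN m) (hx m) (fun s hs => hx n s (hsub hmn hs))
      ((hx1 m).trans (hx1 n).symm)
  have hex : ∀ s : ℝ, 0 < s → ∃ n : ℕ, s ∈ Ioo (1 / ((n : ℝ) + 2)) (n + 2) := by
    intro s hs
    obtain ⟨n, hn⟩ := exists_nat_gt (max s (1 / s))
    have h1 : s < n := (le_max_left _ _).trans_lt hn
    have h2 : 1 / s < n := (le_max_right _ _).trans_lt hn
    refine ⟨n, ?_, by linarith⟩
    rw [one_div_lt (by positivity) hs]
    linarith
  -- At `s`, use the solution on some interval that contains `s`.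
  classical
  let idx : ℝ → ℕ := fun s => if h : 0 < s then (hex s h).choose else 0
  have hidx : ∀ s : ℝ, 0 < s → s ∈ Ioo (1 / ((idx s : ℝ) + 2)) (idx s + 2) := by
    intro s hs
    simp only [idx, dif_pos hs]
    exact (hex s hs).choose_spec
  let y : ℝ → ℝ × ℝ := fun s => x (idx s) s
  have hy : ∀ (n : ℕ), ∀ s ∈ Ioo (1 / ((n : ℝ) + 2)) (n + 2), y s = x n s := by
    intro n s hs
    have hs0 : 0 < s := (show (0 : ℝ) < 1 / ((n : ℝ) + 2) by positivity).trans hs.1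
    rcases le_total (idx s) n with h | h
    · exact hagree h (hidx s hs0)
    · exact (hagree h hs).symm
  have hyd : ∀ s : ℝ, 0 < s → HasDerivAt y ((y s).2, (-1 + 2 * κ / s) * (y s).1) s := by
    intro s hs
    obtain ⟨n, hn⟩ := hex s hs
    rw [hy n s hn]
    refine (hx n s hn).congr_of_eventuallyEq ?_
    filter_upwards [Ioo_mem_nhds hn.1 hn.2] with r hr using hy n r hr
  refine ⟨fun s => (y s).1, fun s => (y s).2, ⟨fun s hs => (hyd s hs).fst,
    fun s hs => (hyd s hs).snd⟩, ?_, ?_⟩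
  · change (x (idx 1) 1).1 = p₀
    rw [hx1]
  · change (x (idx 1) 1).2 = q₀
    rw [hx1]

/-! ### Energy estimates -/

namespace IsCoulombPair

variable {κ : ℝ} {P Q : ℝ → ℝ}

theorem continuousOn_fst (h : IsCoulombPair κ P Q) : ContinuousOn P (Ioi 0) := fun s hs =>
  (h.hasDerivAt_fst s hs).continuousAt.continuousWithinAt

theorem continuousOn_snd (h : IsCoulombPair κ P Q) : ContinuousOn Q (Ioi 0) := fun s hs =>
  (h.hasDerivAt_snd s hs).continuousAt.continuousWithinAt

theorem linearCombination {P' Q' : ℝ → ℝ} (h : IsCoulombPair κ P Q) (h' : IsCoulombPair κ P' Q')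
    (c d : ℝ) : IsCoulombPair κ (fun s => c * P s + d * P' s) (fun s => c * Q s + d * Q' s) :=
  ⟨fun s hs => ((h.1 s hs).const_mul c).add ((h'.1 s hs).const_mul d),
    fun s hs => (((h.2 s hs).const_mul c).add ((h'.2 s hs).const_mul d)).congr_deriv (by ring)⟩

/-- The trivial growth bound, from `(P² + Q²)' = 4κPQ/s`. -/
theorem sq_add_sq_le_rpow (h : IsCoulombPair κ P Q) {s₀ s : ℝ} (hs₀ : 0 < s₀) (hs : s₀ ≤ s) :
    P s ^ 2 + Q s ^ 2 ≤ (P s₀ ^ 2 + Q s₀ ^ 2) * (s / s₀) ^ (2 * |κ|) := by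
  have hsub : Icc s₀ s ⊆ Ioi 0 := fun x hx => hs₀.trans_le hx.1
  have key := le_mul_exp_of_deriv_le (E := fun s => P s ^ 2 + Q s ^ 2)
    (E' := fun s => 2 * P s * Q s + 2 * Q s * ((-1 + 2 * κ / s) * P s))
    (G := fun s => 2 * |κ| * Real.log s) (g := fun s => 2 * |κ| * s⁻¹) hs
    (((h.continuousOn_fst.mono hsub).pow 2).add ((h.continuousOn_snd.mono hsub).pow 2))
    (continuousOn_const.mul (Real.continuousOn_log.mono fun x hx => (hsub hx).ne'))
    (fun x hx => ?_) (fun x hx => (Real.hasDerivAt_log (hs₀.trans hx.1).ne').const_mul _)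
    (fun x hx => ?_)
  · have hs' : 0 < s := hs₀.trans_le hs
    rw [Real.rpow_def_of_pos (div_pos hs' hs₀), Real.log_div hs'.ne' hs₀.ne']
    convert key using 3
    ring
  · have hx0 := hs₀.trans hx.1
    refine (((h.1 x hx0).pow 2).add ((h.2 x hx0).pow 2)).congr_deriv ?_
    simp
  · have hx0 := hs₀.trans hx.1
    have e : 2 * P x * Q x + 2 * Q x * ((-1 + 2 * κ / x) * P x) = x⁻¹ * (2 * (κ * (2 * P x * Q x)))
        := by field_simp; ring
    have e' : 2 * |κ| * x⁻¹ * (P x ^ 2 + Q x ^ 2) = x⁻¹ * (2 * (|κ| * (P x ^ 2 + Q x ^ 2))) := by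
      ring
    rw [e, e']
    refine mul_le_mul_of_nonneg_left (mul_le_mul_of_nonneg_left ?_ zero_le_two) (by positivity)
    refine (le_abs_self _).trans ?_
    rw [abs_mul]
    refine mul_le_mul_of_nonneg_left ?_ (abs_nonneg κ)
    rw [abs_le]
    constructor <;> nlinarith [sq_nonneg (P x - Q x), sq_nonneg (P x + Q x)]

/-- For `s ≥ 1 + 4|κ|` the modified energy `(1 - 2κ/s) P² + Q²` is comparable to `P² + Q²`, and its
derivative `2κP²/s²` is integrable at infinity. -/
theorem sq_add_sq_le_of_large (h : IsCoulombPair κ P Q) {s₀ s : ℝ} (hs₀ : 1 + 4 * |κ| ≤ s₀)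
    (hs : s₀ ≤ s) : P s ^ 2 + Q s ^ 2 ≤ 3 * Real.exp 1 * (P s₀ ^ 2 + Q s₀ ^ 2) := by
  have hκ := abs_nonneg κ
  have hs₀' : 0 < s₀ := by linarith
  have hsub : Icc s₀ s ⊆ Ioi 0 := fun x hx => hs₀'.trans_le hx.1
  have hsmall : ∀ x, s₀ ≤ x → |2 * κ / x| ≤ 1 / 2 := by
    intro x hx
    have : 0 < x := by linarith
    rw [abs_div, abs_mul, abs_two, abs_of_pos this, div_le_iff₀ this]
    linarith
  have key := le_mul_exp_of_deriv_le (E := fun s => (1 - 2 * κ / s) * P s ^ 2 + Q s ^ 2)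
    (E' := fun s => 2 * κ / s ^ 2 * P s ^ 2)
    (G := fun s => -(4 * |κ|) * s⁻¹) (g := fun s => -(4 * |κ|) * -(s ^ 2)⁻¹) hs
    (((continuousOn_const.sub (continuousOn_const.div continuousOn_id
      fun x hx => (hsub hx).ne')).mul ((h.continuousOn_fst.mono hsub).pow 2)).add
        ((h.continuousOn_snd.mono hsub).pow 2))
    (continuousOn_const.mul (continuousOn_inv₀.mono fun x hx => (hsub hx).ne'))
    (fun x hx => ?_) (fun x hx => (hasDerivAt_inv (hs₀'.trans hx.1).ne').const_mul _)
    (fun x hx => ?_)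
  · have hG : Real.exp (-(4 * |κ|) * s⁻¹ - -(4 * |κ|) * s₀⁻¹) ≤ Real.exp 1 := by
      gcongr
      have h1 : 0 ≤ 4 * |κ| * s⁻¹ := by
        have : 0 < s := by linarith
        positivity
      have h2 : 4 * |κ| * s₀⁻¹ ≤ 1 := by
        rw [← div_eq_mul_inv, div_le_one hs₀']; linarith
      linarith
    have a1 := abs_le.1 (hsmall s hs)
    have a0 := abs_le.1 (hsmall s₀ le_rfl)
    have b1 : P s ^ 2 + Q s ^ 2 ≤ 2 * ((1 - 2 * κ / s) * P s ^ 2 + Q s ^ 2) := by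
      nlinarith [sq_nonneg (P s), sq_nonneg (Q s)]
    have b0 : (1 - 2 * κ / s₀) * P s₀ ^ 2 + Q s₀ ^ 2 ≤ 3 / 2 * (P s₀ ^ 2 + Q s₀ ^ 2) := by
      nlinarith [sq_nonneg (P s₀), sq_nonneg (Q s₀)]
    have b2 : 0 ≤ (1 - 2 * κ / s₀) * P s₀ ^ 2 + Q s₀ ^ 2 := by
      nlinarith [sq_nonneg (P s₀), sq_nonneg (Q s₀)]
    calc P s ^ 2 + Q s ^ 2 ≤ 2 * ((1 - 2 * κ / s) * P s ^ 2 + Q s ^ 2) := b1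
      _ ≤ 2 * (((1 - 2 * κ / s₀) * P s₀ ^ 2 + Q s₀ ^ 2) * Real.exp 1) := by
        have := key.trans (mul_le_mul_of_nonneg_left hG b2)
        linarith
      _ ≤ 2 * ((3 / 2 * (P s₀ ^ 2 + Q s₀ ^ 2)) * Real.exp 1) := by gcongr
      _ = _ := by ring
  · have hx0 := hs₀'.trans hx.1
    have d1 : HasDerivAt (fun s : ℝ => 1 - 2 * κ / s) (2 * κ / x ^ 2) x := by
      have := ((hasDerivAt_inv hx0.ne').const_mul (2 * κ)).const_sub 1
      refine this.congr_deriv ?_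
      rw [div_eq_mul_inv]; ring
    refine ((d1.mul ((h.1 x hx0).pow 2)).add ((h.2 x hx0).pow 2)).congr_deriv ?_
    simp only [Nat.cast_ofNat, Nat.add_one_sub_one, pow_one, Pi.pow_apply]
    ring
  · have hx0 := hs₀'.trans hx.1
    have a1 := abs_le.1 (hsmall x hx.1.le)
    have b1 : P x ^ 2 ≤ 2 * ((1 - 2 * κ / x) * P x ^ 2 + Q x ^ 2) := by
      nlinarith [sq_nonneg (P x), sq_nonneg (Q x)]
    have e : 2 * κ / x ^ 2 * P x ^ 2 = (x ^ 2)⁻¹ * (2 * (κ * P x ^ 2)) := by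
      rw [div_eq_mul_inv]; ring
    have e' : -(4 * |κ|) * -(x ^ 2)⁻¹ * ((1 - 2 * κ / x) * P x ^ 2 + Q x ^ 2)
        = (x ^ 2)⁻¹ * (2 * (|κ| * (2 * ((1 - 2 * κ / x) * P x ^ 2 + Q x ^ 2)))) := by ring
    rw [e, e']
    refine mul_le_mul_of_nonneg_left (mul_le_mul_of_nonneg_left ?_ zero_le_two) (by positivity)
    calc κ * P x ^ 2 ≤ |κ| * P x ^ 2 := by gcongr; exact le_abs_self _
      _ ≤ _ := by gcongr

/-- The exponent in the low-frequency estimate: an antiderivative of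
`s ^ (-ε) + s ^ ε + 2 c s ^ (ε - 1)`, whose integral down to `0` converges. -/
noncomputable def lowExponent (c ε s : ℝ) : ℝ :=
  s ^ (1 - ε) / (1 - ε) + s ^ (1 + ε) / (1 + ε) + 2 * c * (s ^ ε / ε)

theorem lowExponent_nonneg {c ε s : ℝ} (hc : 0 ≤ c) (hε : 0 < ε) (hε1 : ε < 1) (hs : 0 < s) :
    0 ≤ lowExponent c ε s := by
  unfold lowExponent
  have : 0 < 1 - ε := by linarith
  positivity

theorem lowExponent_mono {c ε s s' : ℝ} (hc : 0 ≤ c) (hε : 0 < ε) (hε1 : ε < 1) (hs : 0 < s)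
    (hss : s ≤ s') : lowExponent c ε s ≤ lowExponent c ε s' := by
  unfold lowExponent
  have : 0 < 1 - ε := by linarith
  gcongr

theorem hasDerivAt_lowExponent {c ε s : ℝ} (hε : 0 < ε) (hε1 : ε < 1) (hs : 0 < s) :
    HasDerivAt (lowExponent c ε) (s ^ (-ε) + s ^ ε + 2 * c * s ^ (ε - 1)) s := by
  have h1 : (1 - ε) ≠ 0 := by linarith
  have h2 : (1 + ε) ≠ 0 := by linarith
  have d1 := (Real.hasDerivAt_rpow_const (p := 1 - ε) (Or.inl hs.ne')).div_const (1 - ε)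
  have d2 := (Real.hasDerivAt_rpow_const (p := 1 + ε) (Or.inl hs.ne')).div_const (1 + ε)
  have d3 := ((Real.hasDerivAt_rpow_const (p := ε) (Or.inl hs.ne')).div_const ε).const_mul (2 * c)
  refine ((d1.add d2).add d3).congr_deriv ?_
  rw [mul_div_cancel_left₀ _ h1, mul_div_cancel_left₀ _ h2, mul_div_cancel_left₀ _ hε.ne']
  congr 3 <;> ring

/-- For small `s` the first component stays bounded while the second one may grow
logarithmically. The weighted energy `P² + s ^ (2ε) Q²` shows that the loss is at most
`s₀ ^ (-2ε)`. -/
theorem sq_add_sq_le_of_small (h : IsCoulombPair κ P Q) {c ε S s₀ s : ℝ} (hκ : |κ| ≤ c)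
    (hε : 0 < ε) (hε1 : ε < 1) (hS : 1 ≤ S) (hs₀ : 0 < s₀) (hs : s₀ ≤ s) (hsS : s ≤ S) :
    P s ^ 2 + Q s ^ 2 ≤ 2 * S ^ (2 * ε) * S ^ (2 * ε) * Real.exp (lowExponent c ε S)
      * s₀ ^ (-(2 * ε)) * (P s₀ ^ 2 + Q s₀ ^ 2) := by
  have hc : 0 ≤ c := (abs_nonneg κ).trans hκ
  have hs0 : 0 < s := hs₀.trans_le hs
  have hsub : Icc s₀ s ⊆ Ioi 0 := fun x hx => hs₀.trans_le hx.1
  have hrpow : ∀ x : ℝ, 0 < x →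
      HasDerivAt (fun s : ℝ => s ^ (2 * ε)) (2 * ε * x ^ (2 * ε - 1)) x := fun x hx =>
    Real.hasDerivAt_rpow_const (Or.inl hx.ne')
  have key := le_mul_exp_of_deriv_le (E := fun s => P s ^ 2 + s ^ (2 * ε) * Q s ^ 2)
    (E' := fun s => 2 * P s * Q s + (2 * ε * s ^ (2 * ε - 1) * Q s ^ 2
      + s ^ (2 * ε) * (2 * Q s * ((-1 + 2 * κ / s) * P s))))
    (G := fun s => lowExponent c ε s + 2 * ε * Real.log s)
    (g := fun s => (s ^ (-ε) + s ^ ε + 2 * c * s ^ (ε - 1)) + 2 * ε * s⁻¹) hs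
    (((h.continuousOn_fst.mono hsub).pow 2).add
      (ContinuousOn.mul (fun x hx => (hrpow x (hsub hx)).continuousAt.continuousWithinAt)
        ((h.continuousOn_snd.mono hsub).pow 2)))
    (ContinuousOn.add
      (fun x hx => (hasDerivAt_lowExponent hε hε1 (hsub hx)).continuousAt.continuousWithinAt)
      (continuousOn_const.mul (Real.continuousOn_log.mono fun x hx => (hsub hx).ne')))
    (fun x hx => ?_)
    (fun x hx => (hasDerivAt_lowExponent hε hε1 (hs₀.trans hx.1)).add
      ((Real.hasDerivAt_log (hs₀.trans hx.1).ne').const_mul _))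
    (fun x hx => ?_)
  · have hG : Real.exp (lowExponent c ε s + 2 * ε * Real.log s
        - (lowExponent c ε s₀ + 2 * ε * Real.log s₀))
        ≤ Real.exp (lowExponent c ε S) * (s ^ (2 * ε) * s₀ ^ (-(2 * ε))) := by
      rw [Real.rpow_def_of_pos hs0, Real.rpow_def_of_pos hs₀, ← Real.exp_add, ← Real.exp_add]
      gcongr
      have := lowExponent_nonneg hc hε hε1 hs₀
      have := lowExponent_mono hc hε hε1 hs0 hsS
      linarith
    set X := Real.exp (lowExponent c ε S) with hX
    have hXpos : 0 < X := Real.exp_pos _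
    have hSε : 1 ≤ S ^ (2 * ε) := Real.one_le_rpow hS (by linarith)
    have hE0 : P s₀ ^ 2 + s₀ ^ (2 * ε) * Q s₀ ^ 2 ≤ S ^ (2 * ε) * (P s₀ ^ 2 + Q s₀ ^ 2) := by
      have : s₀ ^ (2 * ε) ≤ S ^ (2 * ε) := by gcongr; linarith
      nlinarith [sq_nonneg (P s₀), sq_nonneg (Q s₀)]
    have hsε : 0 < s ^ (2 * ε) := by positivity
    have hsε' : s ^ (2 * ε) ≤ S ^ (2 * ε) := by gcongr
    have hs₀ε : 0 < s₀ ^ (-(2 * ε)) := by positivity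
    have hmain : P s ^ 2 + s ^ (2 * ε) * Q s ^ 2 ≤
        s ^ (2 * ε) * (S ^ (2 * ε) * X * s₀ ^ (-(2 * ε)) * (P s₀ ^ 2 + Q s₀ ^ 2)) := by
      refine key.trans ?_
      calc _ ≤ (S ^ (2 * ε) * (P s₀ ^ 2 + Q s₀ ^ 2)) * (X * (s ^ (2 * ε) * s₀ ^ (-(2 * ε)))) := by
            gcongr
        _ = _ := by ring
    set Y := S ^ (2 * ε) * X * s₀ ^ (-(2 * ε)) * (P s₀ ^ 2 + Q s₀ ^ 2) with hY
    have hY0 : 0 ≤ Y := by positivity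
    have hQ : Q s ^ 2 ≤ Y := by
      refine le_of_mul_le_mul_left ?_ hsε
      nlinarith [sq_nonneg (P s)]
    have hP : P s ^ 2 ≤ S ^ (2 * ε) * Y := by
      have : 0 ≤ s ^ (2 * ε) * Q s ^ 2 := by positivity
      nlinarith
    calc P s ^ 2 + Q s ^ 2 ≤ S ^ (2 * ε) * Y + S ^ (2 * ε) * Y := by nlinarith
      _ = _ := by rw [hY]; ring
  · have hx0 := hs₀.trans hx.1
    refine (((h.1 x hx0).pow 2).add ((hrpow x hx0).mul ((h.2 x hx0).pow 2))).congr_deriv ?_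
    simp only [Nat.cast_ofNat, Nat.add_one_sub_one, pow_one, Pi.pow_apply]
  · have hx0 := hs₀.trans hx.1
    set a := x ^ ε with ha
    have ha0 : 0 < a := by positivity
    have e1 : x ^ (2 * ε) = a ^ 2 := by
      rw [ha, ← Real.rpow_natCast, ← Real.rpow_mul hx0.le]; congr 1; push_cast; ring
    have e2 : x ^ (2 * ε - 1) = a ^ 2 * x⁻¹ := by
      rw [Real.rpow_sub_one hx0.ne', e1, div_eq_mul_inv]
    have e3 : x ^ (-ε) = a⁻¹ := by rw [Real.rpow_neg hx0.le]
    have e4 : x ^ (ε - 1) = a * x⁻¹ := by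
      rw [Real.rpow_sub_one hx0.ne', div_eq_mul_inv]
    rw [e1, e2, e3, e4]
    set y := a * Q x with hy
    set E := P x ^ 2 + y ^ 2 with hE
    have hQ : Q x = a⁻¹ * y := by rw [hy]; field_simp
    have hPy : |2 * P x * y| ≤ E := by
      rw [abs_le]
      constructor <;> nlinarith [sq_nonneg (P x - y), sq_nonneg (P x + y)]
    have hκPy : κ * (2 * P x * y) ≤ c * E :=
      (le_abs_self _).trans (by rw [abs_mul]; gcongr)
    have f1 : a⁻¹ * (2 * P x * y) ≤ a⁻¹ * E := by gcongr; exact (le_abs_self _).trans hPy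
    have f2 : a * -(2 * P x * y) ≤ a * E := by gcongr; exact (neg_le_abs _).trans hPy
    have f3 : 2 * (a * x⁻¹) * (κ * (2 * P x * y)) ≤ 2 * (a * x⁻¹) * (c * E) := by gcongr
    have f4 : 2 * ε * x⁻¹ * y ^ 2 ≤ 2 * ε * x⁻¹ * E := by
      gcongr
      rw [hE]; nlinarith [sq_nonneg (P x)]
    have lhs : 2 * P x * Q x + (2 * ε * (a ^ 2 * x⁻¹) * Q x ^ 2
        + a ^ 2 * (2 * Q x * ((-1 + 2 * κ / x) * P x)))
        = a⁻¹ * (2 * P x * y) + a * -(2 * P x * y) + 2 * (a * x⁻¹) * (κ * (2 * P x * y))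
          + 2 * ε * x⁻¹ * y ^ 2 := by
      rw [hQ]; field_simp; ring
    have hE' : P x ^ 2 + a ^ 2 * Q x ^ 2 = E := by rw [hE, hy]; ring
    rw [lhs, hE']
    linarith

/-- Uniform control for all later times, up to an arbitrarily small power of the starting point. -/
theorem exists_sq_add_sq_le {c ε : ℝ} (hc : 0 ≤ c) (hε : 0 < ε) (hε1 : ε < 1) :
    ∃ K : ℝ, 0 < K ∧ ∀ {κ : ℝ} {P Q : ℝ → ℝ}, IsCoulombPair κ P Q → |κ| ≤ c →
      ∀ {s₀ s : ℝ}, 0 < s₀ → s₀ ≤ s →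
        P s ^ 2 + Q s ^ 2 ≤ K * (1 + s₀ ^ (-(2 * ε))) * (P s₀ ^ 2 + Q s₀ ^ 2) := by
  set S : ℝ := 1 + 4 * c with hS
  have hS1 : 1 ≤ S := by linarith
  set K₁ : ℝ := 2 * S ^ (2 * ε) * S ^ (2 * ε) * Real.exp (lowExponent c ε S) with hK₁
  have hK₁0 : 0 < K₁ := by positivity
  set K₂ : ℝ := 3 * Real.exp 1 with hK₂
  have hK₂1 : 1 ≤ K₂ := by
    have := Real.add_one_le_exp (1 : ℝ)
    rw [hK₂]; linarith
  refine ⟨K₂ * (1 + K₁), by positivity, fun {κ P Q} h hκ {s₀ s} hs₀ hs => ?_⟩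
  have hpow : 0 < s₀ ^ (-(2 * ε)) := by positivity
  have hE : 0 ≤ P s₀ ^ 2 + Q s₀ ^ 2 := by positivity
  rcases le_total s S with h1 | h1
  · refine (h.sq_add_sq_le_of_small hκ hε hε1 hS1 hs₀ hs h1).trans ?_
    rw [← hK₁]
    refine mul_le_mul_of_nonneg_right ?_ hE
    calc K₁ * s₀ ^ (-(2 * ε)) ≤ (1 * (1 + K₁)) * (1 + s₀ ^ (-(2 * ε))) := by
          gcongr <;> linarith
      _ ≤ _ := by gcongr
  · rcases le_total s₀ S with h2 | h2
    · have e1 := h.sq_add_sq_le_of_large (s₀ := S) (s := s) (by linarith) h1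
      have e2 := h.sq_add_sq_le_of_small hκ hε hε1 hS1 hs₀ h2 le_rfl
      rw [← hK₁] at e2
      rw [← hK₂] at e1
      refine e1.trans ((mul_le_mul_of_nonneg_left e2 (by linarith)).trans ?_)
      rw [← mul_assoc, ← mul_assoc]
      refine mul_le_mul_of_nonneg_right ?_ hE
      gcongr <;> linarith
    · refine (h.sq_add_sq_le_of_large (by linarith) hs).trans ?_
      rw [← hK₂]
      refine mul_le_mul_of_nonneg_right ?_ hE
      calc K₂ = K₂ * 1 * 1 := by ring
        _ ≤ _ := by gcongr <;> linarith

end IsCoulombPair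

/-! ### Transition coefficients of the Coulomb system -/

/-- The first component of a chosen Coulomb pair with value `(p, q)` at `1`. -/
noncomputable def coulombFst (κ p q : ℝ) : ℝ → ℝ := (exists_isCoulombPair κ p q).choose

/-- The second component of a chosen Coulomb pair with value `(p, q)` at `1`. -/
noncomputable def coulombSnd (κ p q : ℝ) : ℝ → ℝ := (exists_isCoulombPair κ p q).choose_spec.choose

theorem isCoulombPair_coulomb (κ p q : ℝ) :
    IsCoulombPair κ (coulombFst κ p q) (coulombSnd κ p q) :=
  (exists_isCoulombPair κ p q).choose_spec.choose_spec.1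

theorem coulombFst_one (κ p q : ℝ) : coulombFst κ p q 1 = p :=
  (exists_isCoulombPair κ p q).choose_spec.choose_spec.2.1

theorem coulombSnd_one (κ p q : ℝ) : coulombSnd κ p q 1 = q :=
  (exists_isCoulombPair κ p q).choose_spec.choose_spec.2.2

theorem wronskian_eq_one (κ : ℝ) {s : ℝ} (hs : 0 < s) :
    coulombFst κ 1 0 s * coulombSnd κ 0 1 s - coulombFst κ 0 1 s * coulombSnd κ 1 0 s = 1 := by
  have h1 := isCoulombPair_coulomb κ 1 0
  have h2 := isCoulombPair_coulomb κ 0 1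
  set w : ℝ → ℝ := fun s =>
    coulombFst κ 1 0 s * coulombSnd κ 0 1 s - coulombFst κ 0 1 s * coulombSnd κ 1 0 s with hw
  have hd : ∀ x ∈ Ioi (0 : ℝ), HasDerivAt w 0 x := fun x hx =>
    (((h1.1 x hx).mul (h2.2 x hx)).sub ((h2.1 x hx).mul (h1.2 x hx))).congr_deriv (by ring)
  have := (isOpen_Ioi (a := (0 : ℝ))).is_const_of_deriv_eq_zero isPreconnected_Ioi
    (fun x hx => (hd x hx).differentiableAt.differentiableWithinAt) (fun x hx => (hd x hx).deriv)
    (mem_Ioi.2 hs) (mem_Ioi.2 one_pos)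
  change w s = 1
  rw [this, hw]
  simp [coulombFst_one, coulombSnd_one]

/-- The first component of the Coulomb pair with value `(p, q)` at `s₀ > 0`. -/
noncomputable def transitionFst (κ p q s₀ s : ℝ) : ℝ :=
  (coulombSnd κ 0 1 s₀ * p - coulombFst κ 0 1 s₀ * q) * coulombFst κ 1 0 s
    + (coulombFst κ 1 0 s₀ * q - coulombSnd κ 1 0 s₀ * p) * coulombFst κ 0 1 s

/-- The second component of the Coulomb pair with value `(p, q)` at `s₀ > 0`. -/
noncomputable def transitionSnd (κ p q s₀ s : ℝ) : ℝ :=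
  (coulombSnd κ 0 1 s₀ * p - coulombFst κ 0 1 s₀ * q) * coulombSnd κ 1 0 s
    + (coulombFst κ 1 0 s₀ * q - coulombSnd κ 1 0 s₀ * p) * coulombSnd κ 0 1 s

theorem isCoulombPair_transition (κ p q s₀ : ℝ) :
    IsCoulombPair κ (transitionFst κ p q s₀) (transitionSnd κ p q s₀) :=
  (isCoulombPair_coulomb κ 1 0).linearCombination (isCoulombPair_coulomb κ 0 1) _ _

theorem transitionFst_self (κ p q : ℝ) {s : ℝ} (hs : 0 < s) : transitionFst κ p q s s = p := by
  unfold transitionFst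
  linear_combination p * wronskian_eq_one κ hs

theorem transitionSnd_self (κ p q : ℝ) {s : ℝ} (hs : 0 < s) : transitionSnd κ p q s s = q := by
  unfold transitionSnd
  linear_combination q * wronskian_eq_one κ hs

theorem continuousOn_transition (κ p q : ℝ) {t₀ t : ℝ} (ht₀ : 0 < t₀) (ht : 0 < t) :
    ContinuousOn (fun l => transitionFst κ p q (l * t₀) (l * t)) (Ioi 0) ∧
      ContinuousOn (fun l => transitionSnd κ p q (l * t₀) (l * t)) (Ioi 0) := by
  have hm : ∀ {r : ℝ}, 0 < r → MapsTo (fun l : ℝ => l * r) (Ioi 0) (Ioi 0) := fun hr l hl =>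
    mul_pos hl hr
  have hc : ∀ r : ℝ, ContinuousOn (fun l : ℝ => l * r) (Ioi 0) := fun r => by fun_prop
  have f : ∀ p q : ℝ, ∀ {r : ℝ}, 0 < r →
      ContinuousOn (fun l : ℝ => coulombFst κ p q (l * r)) (Ioi 0) := fun p q {r} hr =>
    (isCoulombPair_coulomb κ p q).continuousOn_fst.comp (hc r) (hm hr)
  have g : ∀ p q : ℝ, ∀ {r : ℝ}, 0 < r →
      ContinuousOn (fun l : ℝ => coulombSnd κ p q (l * r)) (Ioi 0) := fun p q {r} hr =>
    (isCoulombPair_coulomb κ p q).continuousOn_snd.comp (hc r) (hm hr)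
  have k : ∀ c : ℝ, ContinuousOn (fun _ : ℝ => c) (Ioi 0) := fun c => continuousOn_const
  exact ⟨((((g 0 1 ht₀).mul (k _)).sub ((f 0 1 ht₀).mul (k _))).mul (f 1 0 ht)).add
      ((((f 1 0 ht₀).mul (k _)).sub ((g 1 0 ht₀).mul (k _))).mul (f 0 1 ht)),
    ((((g 0 1 ht₀).mul (k _)).sub ((f 0 1 ht₀).mul (k _))).mul (g 1 0 ht)).add
      ((((f 1 0 ht₀).mul (k _)).sub ((g 1 0 ht₀).mul (k _))).mul (g 0 1 ht))⟩

/-- If the complex-valued functions `P`, `Q` solve the Coulomb system, then `v = P + iQ` and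
`w = P - iQ` satisfy `v(s) = α v(s₀) + β w(s₀)`. This is the coefficient `α`. -/
noncomputable def directCoeff (κ s₀ s : ℝ) : ℂ :=
  (((transitionFst κ 1 0 s₀ s + transitionSnd κ 0 1 s₀ s : ℝ) : ℂ)
    + Complex.I * ((transitionSnd κ 1 0 s₀ s - transitionFst κ 0 1 s₀ s : ℝ) : ℂ)) / 2

/-- The coefficient `β` in `v(s) = α v(s₀) + β w(s₀)`, see `directCoeff`. -/
noncomputable def conjCoeff (κ s₀ s : ℝ) : ℂ :=
  (((transitionFst κ 1 0 s₀ s - transitionSnd κ 0 1 s₀ s : ℝ) : ℂ)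
    + Complex.I * ((transitionSnd κ 1 0 s₀ s + transitionFst κ 0 1 s₀ s : ℝ) : ℂ)) / 2

theorem hasDerivAt_directCoeff (κ s₀ : ℝ) {s : ℝ} (hs : 0 < s) :
    HasDerivAt (directCoeff κ s₀) (-Complex.I * directCoeff κ s₀ s + Complex.I * (κ / s)
      * (directCoeff κ s₀ s + starRingEnd ℂ (conjCoeff κ s₀ s))) s := by
  have h1 := isCoulombPair_transition κ 1 0 s₀
  have h2 := isCoulombPair_transition κ 0 1 s₀
  refine ((((h1.1 s hs).add (h2.2 s hs)).ofReal_comp.add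
    (((h1.2 s hs).sub (h2.1 s hs)).ofReal_comp.const_mul Complex.I)).div_const 2).congr_deriv ?_
  simp only [directCoeff, conjCoeff, map_div₀, map_add, map_mul, Complex.conj_I,
    Complex.conj_ofReal, map_ofNat]
  push_cast
  linear_combination (((transitionSnd κ 1 0 s₀ s : ℂ) - transitionFst κ 0 1 s₀ s) / 2
    + (κ / s : ℂ) * transitionFst κ 0 1 s₀ s) * Complex.I_sq

theorem hasDerivAt_conjCoeff (κ s₀ : ℝ) {s : ℝ} (hs : 0 < s) :
    HasDerivAt (conjCoeff κ s₀) (-Complex.I * conjCoeff κ s₀ s + Complex.I * (κ / s)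
      * (conjCoeff κ s₀ s + starRingEnd ℂ (directCoeff κ s₀ s))) s := by
  have h1 := isCoulombPair_transition κ 1 0 s₀
  have h2 := isCoulombPair_transition κ 0 1 s₀
  refine ((((h1.1 s hs).sub (h2.2 s hs)).ofReal_comp.add
    (((h1.2 s hs).add (h2.1 s hs)).ofReal_comp.const_mul Complex.I)).div_const 2).congr_deriv ?_
  simp only [directCoeff, conjCoeff, map_div₀, map_add, map_mul, Complex.conj_I,
    Complex.conj_ofReal, map_ofNat]
  push_cast
  linear_combination (((transitionSnd κ 1 0 s₀ s : ℂ) + transitionFst κ 0 1 s₀ s) / 2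
    - (κ / s : ℂ) * transitionFst κ 0 1 s₀ s) * Complex.I_sq

theorem directCoeff_self (κ : ℝ) {s : ℝ} (hs : 0 < s) : directCoeff κ s s = 1 := by
  simp [directCoeff, transitionFst_self κ _ _ hs, transitionSnd_self κ _ _ hs, one_add_one_eq_two]

theorem conjCoeff_self (κ : ℝ) {s : ℝ} (hs : 0 < s) : conjCoeff κ s s = 0 := by
  simp [conjCoeff, transitionFst_self κ _ _ hs, transitionSnd_self κ _ _ hs]

theorem norm_sq_directCoeff_add (κ s₀ s : ℝ) :
    ‖directCoeff κ s₀ s‖ ^ 2 + ‖conjCoeff κ s₀ s‖ ^ 2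
      = ((transitionFst κ 1 0 s₀ s ^ 2 + transitionSnd κ 1 0 s₀ s ^ 2)
        + (transitionFst κ 0 1 s₀ s ^ 2 + transitionSnd κ 0 1 s₀ s ^ 2)) / 2 := by
  rw [← Complex.normSq_eq_norm_sq, ← Complex.normSq_eq_norm_sq]
  simp only [directCoeff, conjCoeff, map_div₀, mul_comm Complex.I, Complex.normSq_add_mul_I,
    Complex.normSq_ofNat]
  ring

/-! ### The evolution in a single Fourier mode -/

/-- The unimodular factor `t ^ (-iκ)`, for `t > 0`. -/
noncomputable def gaugePhase (κ t : ℝ) : ℂ :=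
  Complex.exp (((-(κ * Real.log t) : ℝ) : ℂ) * Complex.I)

theorem norm_gaugePhase (κ t : ℝ) : ‖gaugePhase κ t‖ = 1 := Complex.norm_exp_ofReal_mul_I _

theorem gaugePhase_mul_conj (κ t : ℝ) : gaugePhase κ t * starRingEnd ℂ (gaugePhase κ t) = 1 := by
  rw [Complex.mul_conj, Complex.normSq_eq_norm_sq, norm_gaugePhase]
  simp

theorem hasDerivAt_gaugePhase (κ : ℝ) {t : ℝ} (ht : 0 < t) :
    HasDerivAt (gaugePhase κ) (-(Complex.I * (κ / t)) * gaugePhase κ t) t := by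
  have h := ((((Real.hasDerivAt_log ht.ne').const_mul κ).neg.ofReal_comp).mul_const
    Complex.I).cexp
  refine h.congr_deriv ?_
  simp only [gaugePhase, Pi.neg_apply]
  push_cast
  ring

/-- In the mode `l = ξ²`, the solution with datum `f̂` at time `t₀` is
`û(t, ξ) = m f̂(ξ) + n conj(f̂(-ξ))`. This is the coefficient `m`. -/
noncomputable def modeDirect (κ t₀ l t : ℝ) : ℂ :=
  gaugePhase κ t * starRingEnd ℂ (gaugePhase κ t₀) * directCoeff κ (l * t₀) (l * t)

/-- The coefficient `n` in `û(t, ξ) = m f̂(ξ) + n conj(f̂(-ξ))`, see `modeDirect`. -/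
noncomputable def modeConj (κ t₀ l t : ℝ) : ℂ :=
  gaugePhase κ t * gaugePhase κ t₀ * conjCoeff κ (l * t₀) (l * t)

theorem modeDirect_self (κ : ℝ) {t₀ l : ℝ} (ht₀ : 0 < t₀) (hl : 0 < l) :
    modeDirect κ t₀ l t₀ = 1 := by
  rw [modeDirect, gaugePhase_mul_conj, directCoeff_self κ (mul_pos hl ht₀), one_mul]

theorem modeConj_self (κ : ℝ) {t₀ l : ℝ} (ht₀ : 0 < t₀) (hl : 0 < l) :
    modeConj κ t₀ l t₀ = 0 := by
  rw [modeConj, conjCoeff_self κ (mul_pos hl ht₀), mul_zero]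

theorem hasDerivAt_modeDirect (κ t₀ : ℝ) {l t : ℝ} (hl : 0 < l) (ht : 0 < t) :
    HasDerivAt (modeDirect κ t₀ l) (-(Complex.I * l) * modeDirect κ t₀ l t
      + Complex.I * (κ / t) * gaugePhase κ t ^ 2 * starRingEnd ℂ (modeConj κ t₀ l t)) t := by
  have h1 : HasDerivAt (fun t => directCoeff κ (l * t₀) (l * t)) _ t :=
    (hasDerivAt_directCoeff κ (l * t₀) (mul_pos hl ht)).scomp t
      ((hasDerivAt_id t).const_mul l)
  refine (((hasDerivAt_gaugePhase κ ht).mul_const _).mul h1).congr_deriv ?_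
  have hl' : (l : ℂ) ≠ 0 := by exact_mod_cast hl.ne'
  have ht' : (t : ℂ) ≠ 0 := by exact_mod_cast ht.ne'
  have hg := gaugePhase_mul_conj κ t
  have e : (l : ℂ) * (κ / (l * t)) = κ / t := by field_simp
  simp only [modeDirect, modeConj, map_mul, Complex.real_smul, mul_one]
  push_cast
  linear_combination (gaugePhase κ t * starRingEnd ℂ (gaugePhase κ t₀) * Complex.I *
      (directCoeff κ (l * t₀) (l * t) + starRingEnd ℂ (conjCoeff κ (l * t₀) (l * t)))) * e
    - (Complex.I * (κ / t) * gaugePhase κ t * starRingEnd ℂ (gaugePhase κ t₀)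
      * starRingEnd ℂ (conjCoeff κ (l * t₀) (l * t))) * hg

theorem hasDerivAt_modeConj (κ t₀ : ℝ) {l t : ℝ} (hl : 0 < l) (ht : 0 < t) :
    HasDerivAt (modeConj κ t₀ l) (-(Complex.I * l) * modeConj κ t₀ l t
      + Complex.I * (κ / t) * gaugePhase κ t ^ 2 * starRingEnd ℂ (modeDirect κ t₀ l t)) t := by
  have h1 : HasDerivAt (fun t => conjCoeff κ (l * t₀) (l * t)) _ t :=
    (hasDerivAt_conjCoeff κ (l * t₀) (mul_pos hl ht)).scomp t
      ((hasDerivAt_id t).const_mul l)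
  refine (((hasDerivAt_gaugePhase κ ht).mul_const _).mul h1).congr_deriv ?_
  have hl' : (l : ℂ) ≠ 0 := by exact_mod_cast hl.ne'
  have ht' : (t : ℂ) ≠ 0 := by exact_mod_cast ht.ne'
  have hg := gaugePhase_mul_conj κ t
  have e : (l : ℂ) * (κ / (l * t)) = κ / t := by field_simp
  simp only [modeDirect, modeConj, map_mul, Complex.real_smul, mul_one, Complex.conj_conj]
  push_cast
  linear_combination (gaugePhase κ t * gaugePhase κ t₀ * Complex.I *
      (conjCoeff κ (l * t₀) (l * t) + starRingEnd ℂ (directCoeff κ (l * t₀) (l * t)))) * e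
    - (Complex.I * (κ / t) * gaugePhase κ t * gaugePhase κ t₀
      * starRingEnd ℂ (directCoeff κ (l * t₀) (l * t))) * hg

theorem norm_modeDirect (κ t₀ l t : ℝ) :
    ‖modeDirect κ t₀ l t‖ = ‖directCoeff κ (l * t₀) (l * t)‖ := by
  simp [modeDirect, norm_gaugePhase]

theorem norm_modeConj (κ t₀ l t : ℝ) :
    ‖modeConj κ t₀ l t‖ = ‖conjCoeff κ (l * t₀) (l * t)‖ := by
  simp [modeConj, norm_gaugePhase]

theorem norm_sq_mode_le_rpow (κ : ℝ) {t₀ l t : ℝ} (ht₀ : 0 < t₀) (hl : 0 < l) (ht : t₀ ≤ t) :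
    ‖modeDirect κ t₀ l t‖ ^ 2 + ‖modeConj κ t₀ l t‖ ^ 2 ≤ (t / t₀) ^ (2 * |κ|) := by
  have hs : 0 < l * t₀ := mul_pos hl ht₀
  have hss : l * t₀ ≤ l * t := by gcongr
  have e1 := (isCoulombPair_transition κ 1 0 (l * t₀)).sq_add_sq_le_rpow hs hss
  have e2 := (isCoulombPair_transition κ 0 1 (l * t₀)).sq_add_sq_le_rpow hs hss
  rw [transitionFst_self κ _ _ hs, transitionSnd_self κ _ _ hs, mul_div_mul_left _ _ hl.ne']
    at e1 e2
  rw [norm_modeDirect, norm_modeConj, norm_sq_directCoeff_add]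
  linarith

theorem norm_mode_le_rpow (κ : ℝ) {t₀ l t : ℝ} (ht₀ : 0 < t₀) (hl : 0 < l) (ht : t₀ ≤ t) :
    ‖modeDirect κ t₀ l t‖ ≤ (t / t₀) ^ |κ| ∧ ‖modeConj κ t₀ l t‖ ≤ (t / t₀) ^ |κ| := by
  have h := norm_sq_mode_le_rpow κ ht₀ hl ht
  have hr : 0 ≤ t / t₀ := div_nonneg (ht₀.le.trans ht) ht₀.le
  have e : (t / t₀) ^ (2 * |κ|) = ((t / t₀) ^ |κ|) ^ 2 := by
    rw [← Real.rpow_natCast, ← Real.rpow_mul hr]; congr 1; push_cast; ring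
  rw [e] at h
  have h0 : 0 ≤ (t / t₀) ^ |κ| := Real.rpow_nonneg hr _
  exact ⟨le_of_sq_le_sq (by nlinarith [sq_nonneg ‖modeConj κ t₀ l t‖]) h0,
    le_of_sq_le_sq (by nlinarith [sq_nonneg ‖modeDirect κ t₀ l t‖]) h0⟩

theorem exists_norm_sq_mode_le {c ε : ℝ} (hc : 0 ≤ c) (hε : 0 < ε) (hε1 : ε < 1) :
    ∃ K : ℝ, 0 < K ∧ ∀ {κ : ℝ}, |κ| ≤ c → ∀ {t₀ l t : ℝ}, 0 < t₀ → 0 < l → t₀ ≤ t →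
      ‖modeDirect κ t₀ l t‖ ^ 2 + ‖modeConj κ t₀ l t‖ ^ 2 ≤ K * (1 + (l * t₀) ^ (-(2 * ε))) := by
  obtain ⟨K, hK, h⟩ := IsCoulombPair.exists_sq_add_sq_le hc hε hε1
  refine ⟨K, hK, fun {κ} hκ {t₀ l t} ht₀ hl ht => ?_⟩
  have hs : 0 < l * t₀ := mul_pos hl ht₀
  have hss : l * t₀ ≤ l * t := by gcongr
  have e1 := h (isCoulombPair_transition κ 1 0 (l * t₀)) hκ hs hss
  have e2 := h (isCoulombPair_transition κ 0 1 (l * t₀)) hκ hs hss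
  rw [transitionFst_self κ _ _ hs, transitionSnd_self κ _ _ hs] at e1 e2
  rw [norm_modeDirect, norm_modeConj, norm_sq_directCoeff_add]
  linarith

theorem continuousOn_modeDirect (κ : ℝ) {t₀ t : ℝ} (ht₀ : 0 < t₀) (ht : 0 < t) :
    ContinuousOn (fun l => modeDirect κ t₀ l t) (Ioi 0) := by
  have h1 := continuousOn_transition κ 1 0 ht₀ ht
  have h2 := continuousOn_transition κ 0 1 ht₀ ht
  exact continuousOn_const.mul (((Complex.continuous_ofReal.comp_continuousOn (h1.1.add h2.2)).add
    (continuousOn_const.mul (Complex.continuous_ofReal.comp_continuousOn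
      (h1.2.sub h2.1)))).div_const 2)

theorem continuousOn_modeConj (κ : ℝ) {t₀ t : ℝ} (ht₀ : 0 < t₀) (ht : 0 < t) :
    ContinuousOn (fun l => modeConj κ t₀ l t) (Ioi 0) := by
  have h1 := continuousOn_transition κ 1 0 ht₀ ht
  have h2 := continuousOn_transition κ 0 1 ht₀ ht
  exact continuousOn_const.mul (((Complex.continuous_ofReal.comp_continuousOn (h1.1.sub h2.2)).add
    (continuousOn_const.mul (Complex.continuous_ofReal.comp_continuousOn
      (h1.2.add h2.1)))).div_const 2)

/-! ### Convergence of the profile in a single Fourier mode -/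

/-- If `W' = i(κ/τ) e(τ) conj X` and `X' = i(κ/τ) e(τ) conj W`, where `e` oscillates with frequency
`2l - 2κ/τ`, then one integration by parts, which replaces `W` by
`W - κ/(2lτ) e(τ) conj X`, makes the derivative `O(1/(lτ²))`. -/
theorem norm_sub_le_of_oscillating {κ l M t t' : ℝ} {W X e : ℝ → ℂ} (hl : 0 < l) (ht : 0 < t)
    (htt : t ≤ t')
    (hW : ∀ τ, t ≤ τ → HasDerivAt W (Complex.I * (κ / τ) * e τ * starRingEnd ℂ (X τ)) τ)
    (hX : ∀ τ, t ≤ τ → HasDerivAt X (Complex.I * (κ / τ) * e τ * starRingEnd ℂ (W τ)) τ)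
    (he : ∀ τ, t ≤ τ → HasDerivAt e (Complex.I * (2 * l - 2 * (κ / τ)) * e τ) τ)
    (hen : ∀ τ, ‖e τ‖ = 1) (hWM : ∀ τ, t ≤ τ → ‖W τ‖ ≤ M) (hXM : ∀ τ, t ≤ τ → ‖X τ‖ ≤ M) :
    ‖W t' - W t‖ ≤ (|κ| * (3 + 3 * |κ|)) / 2 * (M * (l * t)⁻¹) := by
  have hM : 0 ≤ M := (norm_nonneg _).trans (hWM t le_rfl)
  have hlc : (l : ℂ) ≠ 0 := by exact_mod_cast hl.ne'
  set g : ℝ → ℂ := fun τ => κ / (2 * l) * ((τ⁻¹ : ℝ) : ℂ) * e τ with hg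
  have hgn : ∀ τ, t ≤ τ → ‖g τ‖ = |κ| / (2 * l) * τ⁻¹ := by
    intro τ hτ
    have : 0 < τ := ht.trans_le hτ
    simp only [hg, norm_mul, hen, mul_one, norm_div, Complex.norm_real, Real.norm_eq_abs, abs_inv,
      abs_of_pos this, abs_of_pos hl, Complex.norm_ofNat]
  set V : ℝ → ℂ := fun τ => W τ - g τ * starRingEnd ℂ (X τ) with hV
  have hVd : ∀ τ, t ≤ τ → HasDerivAt V ((κ / (2 * l) * ((τ⁻¹ : ℝ) : ℂ) ^ 2 * e τ) *
      ((1 + 2 * Complex.I * κ) * starRingEnd ℂ (X τ)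
        + Complex.I * κ * starRingEnd ℂ (e τ) * W τ)) τ := by
    intro τ hτ
    have hτ0 : 0 < τ := ht.trans_le hτ
    have hτc : (τ : ℂ) ≠ 0 := by exact_mod_cast hτ0.ne'
    have d1 : HasDerivAt g _ τ :=
      (((hasDerivAt_inv hτ0.ne').ofReal_comp).const_mul ((κ : ℂ) / (2 * l))).mul (he τ hτ)
    have d2 : HasDerivAt (fun τ => starRingEnd ℂ (X τ))
        (starRingEnd ℂ (Complex.I * (κ / τ) * e τ * starRingEnd ℂ (W τ))) τ := (hX τ hτ).star
    refine ((hW τ hτ).sub (d1.mul d2)).congr_deriv ?_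
    simp only [hg, map_mul, Complex.conj_I, map_div₀, Complex.conj_ofReal,
      Complex.conj_conj]
    push_cast
    field_simp
    ring
  have hVb : ∀ τ, t ≤ τ → ‖(κ / (2 * l) * ((τ⁻¹ : ℝ) : ℂ) ^ 2 * e τ) *
      ((1 + 2 * Complex.I * κ) * starRingEnd ℂ (X τ)
        + Complex.I * κ * starRingEnd ℂ (e τ) * W τ)‖
      ≤ (|κ| / (2 * l) * ((1 + 3 * |κ|) * M)) * (τ ^ 2)⁻¹ := by
    intro τ hτ
    have hτ0 : 0 < τ := ht.trans_le hτ
    rw [norm_mul]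
    have n1 : ‖κ / (2 * l) * ((τ⁻¹ : ℝ) : ℂ) ^ 2 * e τ‖ = |κ| / (2 * l) * (τ ^ 2)⁻¹ := by
      simp only [norm_mul, hen, mul_one, norm_div, Complex.norm_real, Real.norm_eq_abs, abs_inv,
        abs_of_pos hτ0, abs_of_pos hl, Complex.norm_ofNat, norm_pow, inv_pow]
    have n2 : ‖(1 + 2 * Complex.I * κ) * starRingEnd ℂ (X τ)
        + Complex.I * κ * starRingEnd ℂ (e τ) * W τ‖ ≤ (1 + 3 * |κ|) * M := by
      have m1 : ‖(1 + 2 * Complex.I * κ : ℂ)‖ ≤ 1 + 2 * |κ| := by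
        refine (norm_add_le _ _).trans ?_
        simp
      refine (norm_add_le _ _).trans ?_
      rw [norm_mul, norm_mul, norm_mul, norm_mul, RCLike.norm_conj, RCLike.norm_conj, hen,
        Complex.norm_I, Complex.norm_real, Real.norm_eq_abs]
      have p1 := mul_le_mul m1 (hXM τ hτ) (norm_nonneg _) (by positivity)
      have p2 := mul_le_mul_of_nonneg_left (hWM τ hτ) (abs_nonneg κ)
      nlinarith
    rw [n1]
    calc _ ≤ |κ| / (2 * l) * (τ ^ 2)⁻¹ * ((1 + 3 * |κ|) * M) := by gcongr
      _ = _ := by ring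
  set A : ℝ := |κ| / (2 * l) * ((1 + 3 * |κ|) * M) with hA
  have hA0 : 0 ≤ A := by positivity
  have hB : ∀ τ, t ≤ τ → HasDerivAt (fun τ : ℝ => A * (t⁻¹ - τ⁻¹)) (A * (τ ^ 2)⁻¹) τ := by
    intro τ hτ
    have hτ0 : 0 < τ := ht.trans_le hτ
    refine (((hasDerivAt_inv hτ0.ne').const_sub t⁻¹).const_mul A).congr_deriv ?_
    ring
  have hVV : ‖V t' - V t‖ ≤ A * (t⁻¹ - t'⁻¹) := by
    refine image_norm_le_of_norm_deriv_right_le_deriv_boundary' (f := fun τ => V τ - V t)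
      (a := t) (b := t') (B := fun τ : ℝ => A * (t⁻¹ - τ⁻¹))
      (fun τ hτ => ((hVd τ hτ.1).sub_const _).continuousAt.continuousWithinAt)
      (fun τ hτ => ((hVd τ hτ.1).sub_const _).hasDerivWithinAt) (by simp)
      (fun τ hτ => (hB τ hτ.1).continuousAt.continuousWithinAt)
      (fun τ hτ => (hB τ hτ.1).hasDerivWithinAt)
      (fun τ hτ => hVb τ hτ.1) (right_mem_Icc.2 htt)
  have hgX : ∀ τ, t ≤ τ → ‖g τ * starRingEnd ℂ (X τ)‖ ≤ |κ| / (2 * l) * t⁻¹ * M := by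
    intro τ hτ
    rw [norm_mul, hgn τ hτ, RCLike.norm_conj]
    have := hXM τ hτ
    gcongr
  have hWeq : W t' - W t = (V t' - V t) + g t' * starRingEnd ℂ (X t')
      - g t * starRingEnd ℂ (X t) := by simp only [hV]; ring
  rw [hWeq]
  refine (norm_sub_le _ _).trans ((add_le_add_left (norm_add_le _ _) _).trans ?_)
  have ht'0 : 0 ≤ t'⁻¹ := inv_nonneg.2 (ht.le.trans htt)
  have e1 : A * (t⁻¹ - t'⁻¹) ≤ A * t⁻¹ := by gcongr; linarith
  have e2 := hgX t' htt
  have e3 := hgX t le_rfl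
  have e4 : A * t⁻¹ + |κ| / (2 * l) * t⁻¹ * M + |κ| / (2 * l) * t⁻¹ * M
      = (|κ| * (3 + 3 * |κ|)) / 2 * (M * (l * t)⁻¹) := by
    rw [hA, mul_inv]; field_simp; ring
  linarith

/-- The unimodular factor `e^{ilτ}`, which undoes the free flow of the mode `l` over time `τ`. -/
noncomputable def freePhase (l τ : ℝ) : ℂ := Complex.exp (((l * τ : ℝ) : ℂ) * Complex.I)

theorem norm_freePhase (l τ : ℝ) : ‖freePhase l τ‖ = 1 := Complex.norm_exp_ofReal_mul_I _

theorem freePhase_mul_conj (l τ : ℝ) : freePhase l τ * starRingEnd ℂ (freePhase l τ) = 1 := by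
  rw [Complex.mul_conj, Complex.normSq_eq_norm_sq, norm_freePhase]
  simp

theorem hasDerivAt_freePhase (l t₀ t : ℝ) :
    HasDerivAt (fun t => freePhase l (t - t₀)) (Complex.I * l * freePhase l (t - t₀)) t := by
  have h := (((((hasDerivAt_id t).sub_const t₀).const_mul l).ofReal_comp).mul_const
    Complex.I).cexp
  refine h.congr_deriv ?_
  simp only [freePhase, id_eq]
  push_cast
  ring

/-- The profiles `e^{il(t-t₀)} m` and `e^{il(t-t₀)} n` converge as `t → ∞`, at rate `1/(lt)`. -/
theorem exists_norm_profile_sub_le {c ε : ℝ} (hc : 0 ≤ c) (hε : 0 < ε) (hε1 : ε < 1) :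
    ∃ K : ℝ, 0 < K ∧ ∀ {κ : ℝ}, |κ| ≤ c → ∀ {t₀ l t t' : ℝ}, 0 < t₀ → 0 < l → t₀ ≤ t → t ≤ t' →
      ‖freePhase l (t' - t₀) * modeDirect κ t₀ l t' - freePhase l (t - t₀) * modeDirect κ t₀ l t‖ ^ 2
          ≤ K * (min 1 (l * t)⁻¹ ^ 2 * (1 + (l * t₀) ^ (-(2 * ε)))) ∧
      ‖freePhase l (t' - t₀) * modeConj κ t₀ l t' - freePhase l (t - t₀) * modeConj κ t₀ l t‖ ^ 2
          ≤ K * (min 1 (l * t)⁻¹ ^ 2 * (1 + (l * t₀) ^ (-(2 * ε)))) := by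
  obtain ⟨K, hK, h⟩ := exists_norm_sq_mode_le hc hε hε1
  set C : ℝ := 2 + (c * (3 + 3 * c)) / 2 with hC
  have hC0 : 0 ≤ C := by positivity
  refine ⟨C ^ 2 * K, by positivity, fun {κ} hκ {t₀ l t t'} ht₀ hl ht htt => ?_⟩
  have ht0 : 0 < t := ht₀.trans_le ht
  set M : ℝ := Real.sqrt (K * (1 + (l * t₀) ^ (-(2 * ε)))) with hM
  have hlt₀ : 0 < l * t₀ := mul_pos hl ht₀
  have hM2 : M ^ 2 = K * (1 + (l * t₀) ^ (-(2 * ε))) := Real.sq_sqrt (by positivity)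
  have hM0 : 0 ≤ M := Real.sqrt_nonneg _
  set W : ℝ → ℂ := fun t => freePhase l (t - t₀) * modeDirect κ t₀ l t with hW
  set X : ℝ → ℂ := fun t => freePhase l (t - t₀) * modeConj κ t₀ l t with hX
  set e : ℝ → ℂ := fun t => gaugePhase κ t ^ 2 * freePhase l (t - t₀) ^ 2 with he
  have hWM : ∀ τ, t ≤ τ → ‖W τ‖ ≤ M := fun τ hτ => by
    rw [hW, hM]
    simp only [norm_mul, norm_freePhase, one_mul]
    refine Real.le_sqrt_of_sq_le ?_
    nlinarith [h hκ ht₀ hl (ht.trans hτ), sq_nonneg ‖modeConj κ t₀ l τ‖]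
  have hXM : ∀ τ, t ≤ τ → ‖X τ‖ ≤ M := fun τ hτ => by
    rw [hX, hM]
    simp only [norm_mul, norm_freePhase, one_mul]
    refine Real.le_sqrt_of_sq_le ?_
    nlinarith [h hκ ht₀ hl (ht.trans hτ), sq_nonneg ‖modeDirect κ t₀ l τ‖]
  have hWd : ∀ τ, t ≤ τ →
      HasDerivAt W (Complex.I * (κ / τ) * e τ * starRingEnd ℂ (X τ)) τ := fun τ hτ => by
    refine ((hasDerivAt_freePhase l t₀ τ).mul
      (hasDerivAt_modeDirect κ t₀ hl (ht0.trans_le hτ))).congr_deriv ?_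
    simp only [he, hX, map_mul]
    linear_combination -(Complex.I * (κ / τ) * gaugePhase κ τ ^ 2 * freePhase l (τ - t₀)
      * starRingEnd ℂ (modeConj κ t₀ l τ)) * freePhase_mul_conj l (τ - t₀)
  have hXd : ∀ τ, t ≤ τ →
      HasDerivAt X (Complex.I * (κ / τ) * e τ * starRingEnd ℂ (W τ)) τ := fun τ hτ => by
    refine ((hasDerivAt_freePhase l t₀ τ).mul
      (hasDerivAt_modeConj κ t₀ hl (ht0.trans_le hτ))).congr_deriv ?_
    simp only [he, hW, map_mul]
    linear_combination -(Complex.I * (κ / τ) * gaugePhase κ τ ^ 2 * freePhase l (τ - t₀)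
      * starRingEnd ℂ (modeDirect κ t₀ l τ)) * freePhase_mul_conj l (τ - t₀)
  have hed : ∀ τ, t ≤ τ →
      HasDerivAt e (Complex.I * (2 * l - 2 * (κ / τ)) * e τ) τ := fun τ hτ => by
    refine (((hasDerivAt_gaugePhase κ (ht0.trans_le hτ)).pow 2).mul
      ((hasDerivAt_freePhase l t₀ τ).pow 2)).congr_deriv ?_
    simp only [he, Nat.cast_ofNat, Nat.add_one_sub_one, pow_one, Pi.pow_apply]
    ring
  have hen : ∀ τ, ‖e τ‖ = 1 := fun τ => by
    simp [he, norm_gaugePhase, norm_freePhase]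
  have hcc : (|κ| * (3 + 3 * |κ|)) / 2 ≤ C := by
    have : (|κ| * (3 + 3 * |κ|)) / 2 ≤ (c * (3 + 3 * c)) / 2 := by gcongr
    linarith
  have hlt : 0 < (l * t)⁻¹ := by positivity
  have fin : ∀ {x : ℂ}, ‖x‖ ≤ 2 * M → ‖x‖ ≤ (|κ| * (3 + 3 * |κ|)) / 2 * (M * (l * t)⁻¹) →
      ‖x‖ ^ 2 ≤ C ^ 2 * K * (min 1 (l * t)⁻¹ ^ 2 * (1 + (l * t₀) ^ (-(2 * ε)))) := by
    intro x h1 h2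
    have h3 : ‖x‖ ≤ C * (M * min 1 (l * t)⁻¹) := by
      rcases le_total 1 (l * t)⁻¹ with h4 | h4
      · rw [min_eq_left h4, mul_one]
        refine h1.trans ?_
        gcongr
        rw [hC]
        have : 0 ≤ (c * (3 + 3 * c)) / 2 := by positivity
        linarith
      · rw [min_eq_right h4]
        exact h2.trans (by gcongr)
    calc ‖x‖ ^ 2 ≤ (C * (M * min 1 (l * t)⁻¹)) ^ 2 := by gcongr
      _ = C ^ 2 * M ^ 2 * min 1 (l * t)⁻¹ ^ 2 := by ring
      _ = _ := by rw [hM2]; ring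
  refine ⟨fin ?_ (norm_sub_le_of_oscillating hl ht0 htt hWd hXd hed hen hWM hXM),
    fin ?_ (norm_sub_le_of_oscillating hl ht0 htt hXd hWd hed hen hXM hWM)⟩
  · exact (norm_sub_le _ _).trans (by linarith [hWM t' htt, hWM t le_rfl])
  · exact (norm_sub_le _ _).trans (by linarith [hXM t' htt, hXM t le_rfl])

/-! ### The equation on the Fourier side -/

/-- The symbol `ξ²` of `-∂ₓ²`, in terms of the frequency variable `k = ξ / 2π` of `𝓕`. -/
noncomputable def symbolSq (k : ℝ) : ℝ := (2 * Real.pi * k) ^ 2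

theorem symbolSq_pos {k : ℝ} (hk : k ≠ 0) : 0 < symbolSq k := by
  unfold symbolSq
  have := Real.pi_pos
  positivity

theorem symbolSq_neg (k : ℝ) : symbolSq (-k) = symbolSq k := by
  unfold symbolSq; ring

theorem continuous_symbolSq : Continuous symbolSq := by
  unfold symbolSq; fun_prop

theorem fourier_fourier_apply (ψ : 𝓢(ℝ, ℂ)) (x : ℝ) : 𝓕 (𝓕 ψ) x = ψ (-x) := by
  have h : 𝓕⁻ (𝓕 ψ) (-x) = ψ (-x) := by rw [FourierTransform.fourierInv_fourier_eq]
  rw [← h, SchwartzMap.fourierInv_coe, SchwartzMap.fourier_coe, Real.fourierInv_eq_fourier_neg,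
    neg_neg]

/-- Transposition of the Fourier transform on `L²`. -/
theorem integral_mul_fourier (f : L2) (ψ : 𝓢(ℝ, ℂ)) :
    ∫ x, f x * 𝓕 ψ x = ∫ k, (𝓕 f : L2) k * ψ k := by
  have h := congrArg (fun T => T ψ) (Lp.fourier_toTemperedDistribution_eq f)
  simp only [TemperedDistribution.fourier_apply, Lp.toTemperedDistribution_apply, smul_eq_mul] at h
  simpa only [mul_comm] using h

theorem inner_toLp_eq_integral (f : L2) (ψ : 𝓢(ℝ, ℂ)) :
    inner ℂ f (ψ.toLp 2) = ∫ x, starRingEnd ℂ (f x) * ψ x := by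
  rw [L2.inner_def]
  refine integral_congr_ae ?_
  filter_upwards [ψ.coeFn_toLp 2] with x hx
  rw [hx, RCLike.inner_apply, mul_comm]

/-- The Fourier transform turns complex conjugation into `g ↦ conj (g (-·))`. -/
theorem integral_conj_mul_fourier (f : L2) (ψ : 𝓢(ℝ, ℂ)) :
    ∫ x, starRingEnd ℂ (f x) * 𝓕 ψ x = ∫ k, starRingEnd ℂ ((𝓕 f : L2) (-k)) * ψ k := by
  rw [← inner_toLp_eq_integral, ← Lp.inner_fourier_eq, SchwartzMap.toLp_fourier_eq,
    inner_toLp_eq_integral, ← integral_neg_eq_self]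
  simp only [fourier_fourier_apply, neg_neg]

theorem integral_mul_iteratedDeriv_fourier (f : L2) (ψ : 𝓢(ℝ, ℂ)) :
    ∫ x, f x * iteratedDeriv 2 (𝓕 ψ : 𝓢(ℝ, ℂ)) x = -∫ k, (𝓕 f : L2) k * (symbolSq k * ψ k) := by
  have hg : (fun k : ℝ => (-(symbolSq k : ℂ))).HasTemperateGrowth := by
    unfold symbolSq; fun_prop
  have hint : ∀ n : ℕ, Integrable (fun x : ℝ => x ^ n • ψ x) := fun n => by
    refine (integrable_norm_iff ?_).1 ?_
    · exact ((continuous_id.pow n).smul ψ.continuous).aestronglyMeasurable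
    · simpa only [norm_smul, norm_pow] using ψ.integrable_pow_mul volume n
  have e : iteratedDeriv 2 (𝓕 ψ : 𝓢(ℝ, ℂ))
      = (𝓕 (SchwartzMap.smulLeftCLM ℂ (fun k => -(symbolSq k : ℂ)) ψ) : 𝓢(ℝ, ℂ)) := by
    rw [SchwartzMap.fourier_coe, SchwartzMap.fourier_coe,
      Real.iteratedDeriv_fourier (N := 2) (fun n _ => hint n) le_rfl]
    congr 1
    ext k
    rw [SchwartzMap.smulLeftCLM_apply_apply hg, smul_eq_mul, smul_eq_mul]
    congr 1
    rw [symbolSq]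
    push_cast
    linear_combination (4 * (Real.pi : ℂ) ^ 2 * (k : ℂ) ^ 2) * Complex.I_sq
  rw [e, integral_mul_fourier, ← integral_neg]
  congr 1
  ext k
  rw [SchwartzMap.smulLeftCLM_apply_apply hg, smul_eq_mul]
  ring

/-! ### Pairings and multipliers on `L²` -/

theorem integral_mul_eq_inner_star (f g : L2) : ∫ x, f x * g x = inner ℂ (star f) g := by
  rw [L2.inner_def]
  refine integral_congr_ae ?_
  filter_upwards [Lp.coeFn_star f] with x hx
  rw [hx, RCLike.inner_apply, Pi.star_apply, ← starRingEnd_apply, Complex.conj_conj, mul_comm]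

theorem norm_star_L2 (f : L2) : ‖star f‖ = ‖f‖ := by
  have h : ∀ᵐ x, ‖(star f : L2) x‖ = ‖f x‖ := by
    filter_upwards [Lp.coeFn_star f] with x hx
    rw [hx, Pi.star_apply, norm_star]
  exact le_antisymm (Lp.norm_le_norm_of_ae_le (h.mono fun _ hx => hx.le))
    (Lp.norm_le_norm_of_ae_le (h.mono fun _ hx => hx.ge))

theorem norm_integral_mul_le (f g : L2) : ‖∫ x, f x * g x‖ ≤ ‖f‖ * ‖g‖ := by
  rw [integral_mul_eq_inner_star]
  simpa only [norm_star_L2] using norm_inner_le_norm (𝕜 := ℂ) (star f) g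

theorem integral_mul_schwartz_eq (f : L2) (φ : 𝓢(ℝ, ℂ)) :
    ∫ x, f x * φ x = ∫ x, f x * (φ.toLp 2 : L2) x := by
  refine integral_congr_ae ?_
  filter_upwards [φ.coeFn_toLp 2] with x hx
  rw [hx]

theorem norm_integral_mul_schwartz_le (f : L2) (φ : 𝓢(ℝ, ℂ)) :
    ‖∫ x, f x * φ x‖ ≤ ‖f‖ * ‖(φ.toLp 2 : L2)‖ := by
  rw [integral_mul_schwartz_eq]
  exact norm_integral_mul_le _ _

theorem integrable_mul_schwartz (f : L2) (φ : 𝓢(ℝ, ℂ)) : Integrable fun x => f x * φ x :=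
  (Lp.memLp f).integrable_mul (φ.memLp 2 volume)

theorem integral_sub_mul_schwartz (f g : L2) (φ : 𝓢(ℝ, ℂ)) :
    ∫ x, (f - g) x * φ x = (∫ x, f x * φ x) - ∫ x, g x * φ x := by
  rw [← integral_sub (integrable_mul_schwartz f φ) (integrable_mul_schwartz g φ)]
  refine integral_congr_ae ?_
  filter_upwards [Lp.coeFn_sub f g] with x hx
  rw [hx, Pi.sub_apply, sub_mul]

/-- Duality: the `L²` norm is determined by pairings with Schwartz functions. -/
theorem norm_le_of_forall_schwartz {f : L2} {b : ℝ}
    (h : ∀ φ : 𝓢(ℝ, ℂ), ‖∫ x, f x * φ x‖ ≤ b * ‖(φ.toLp 2 : L2)‖) (hb : 0 ≤ b) : ‖f‖ ≤ b := by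
  have h' : ∀ g : L2, ‖inner ℂ (star f) g‖ ≤ b * ‖g‖ := fun g => by
    refine DenseRange.induction_on (p := fun g : L2 => ‖inner ℂ (star f) g‖ ≤ b * ‖g‖)
      (SchwartzMap.denseRange_toLpCLM (E := ℝ) (F := ℂ) (μ := volume) (p := 2)
        ENNReal.ofNat_ne_top) g ?_ fun φ => ?_
    · exact isClosed_le (by fun_prop) (by fun_prop)
    · rw [SchwartzMap.toLpCLM_apply, ← integral_mul_eq_inner_star, ← integral_mul_schwartz_eq]
      exact h φ
  have h1 := h' (star f)
  rw [inner_self_eq_norm_sq_to_K, norm_star_L2] at h1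
  simp only [Complex.coe_algebraMap, norm_pow, Complex.norm_real, norm_norm] at h1
  rcases (norm_nonneg f).eq_or_lt with h0 | h0
  · rw [← h0]; exact hb
  · rw [sq] at h1
    exact le_of_mul_le_mul_right h1 h0

/-- Multiplication of `g : L²` by the function `c`; junk value `0` if `c g` is not in `L²`. -/
noncomputable def mulL2 (c : ℝ → ℂ) (g : L2) : L2 :=
  open scoped Classical in
  if h : MemLp (fun k => c k * g k) 2 volume then h.toLp _ else 0

theorem coeFn_mulL2 {c : ℝ → ℂ} {C : ℝ} (hc : AEStronglyMeasurable c volume)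
    (hC : ∀ᵐ k, ‖c k‖ ≤ C) (g : L2) : mulL2 c g =ᵐ[volume] fun k => c k * g k := by
  have h : MemLp (fun k => c k * g k) 2 volume := by
    refine MemLp.of_le_mul (c := C) (Lp.memLp g) (hc.mul (Lp.aestronglyMeasurable g)) ?_
    filter_upwards [hC] with k hk
    rw [norm_mul]
    gcongr
  rw [mulL2, dif_pos h]
  exact h.coeFn_toLp

/-- The map `g ↦ conj (g (-·))`, which is complex conjugation seen through the Fourier transform. -/
noncomputable def reflConj (g : L2) : L2 :=
  Lp.compMeasurePreserving (fun k : ℝ => -k) (Measure.measurePreserving_neg volume) (star g)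

theorem ae_neg_of_ae {p : ℝ → Prop} (h : ∀ᵐ k : ℝ, p k) : ∀ᵐ k : ℝ, p (-k) :=
  (Measure.measurePreserving_neg (volume : Measure ℝ)).quasiMeasurePreserving.ae h

theorem coeFn_reflConj (g : L2) :
    reflConj g =ᵐ[volume] fun k => starRingEnd ℂ (g (-k)) := by
  have h1 := Lp.coeFn_compMeasurePreserving (star g)
    (Measure.measurePreserving_neg (volume : Measure ℝ))
  have h2 := ae_neg_of_ae (Lp.coeFn_star g)
  filter_upwards [h1, h2] with k h1 h2
  rw [reflConj, h1, Function.comp_apply, h2]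
  rfl

theorem norm_reflConj (g : L2) : ‖reflConj g‖ = ‖g‖ := by
  rw [reflConj, Lp.norm_compMeasurePreserving, norm_star_L2]

theorem reflConj_sub (f g : L2) : reflConj (f - g) = reflConj f - reflConj g := by
  refine Lp.ext ?_
  filter_upwards [coeFn_reflConj (f - g), coeFn_reflConj f, coeFn_reflConj g,
    Lp.coeFn_sub (reflConj f) (reflConj g), ae_neg_of_ae (Lp.coeFn_sub f g)] with k h1 h2 h3 h4 h5
  rw [h1, h4, Pi.sub_apply, h2, h3, h5, Pi.sub_apply, map_sub]

theorem integral_reflConj_mul (f : L2) (φ : 𝓢(ℝ, ℂ)) :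
    ∫ k, starRingEnd ℂ (f (-k)) * φ k = ∫ k, reflConj f k * φ k := by
  refine integral_congr_ae ?_
  filter_upwards [coeFn_reflConj f] with k hk
  rw [hk]

/-! ### The weak equation in Fourier variables -/

/-- Multiplication of a Schwartz function by the symbol `ξ²`. -/
noncomputable def symbolMul (ψ : 𝓢(ℝ, ℂ)) : 𝓢(ℝ, ℂ) :=
  SchwartzMap.smulLeftCLM ℂ (fun k => (symbolSq k : ℂ)) ψ

theorem symbolMul_apply (ψ : 𝓢(ℝ, ℂ)) (k : ℝ) : symbolMul ψ k = symbolSq k * ψ k := by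
  have hg : (fun k : ℝ => (symbolSq k : ℂ)).HasTemperateGrowth := by
    unfold symbolSq; fun_prop
  rw [symbolMul, SchwartzMap.smulLeftCLM_apply_apply hg, smul_eq_mul]

/-- The equation `∂ₜ U = -iξ² U + i(κ/t) t^{-2iκ} conj (U (-·))`, tested against Schwartz functions
of the frequency. -/
structure IsFourierSolution (κ t₀ : ℝ) (U : ℝ → L2) : Prop where
  continuousOn : ContinuousOn U (Ici t₀)
  hasDerivAt : ∀ ψ : 𝓢(ℝ, ℂ), ∀ t : ℝ, t₀ < t → HasDerivAt (fun s => ∫ k, U s k * ψ k)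
    (-(Complex.I * ∫ k, U t k * symbolMul ψ k)
      + Complex.I * (κ / t) * gaugePhase κ t ^ 2 * ∫ k, reflConj (U t) k * ψ k) t

theorem potential_eq (σ a : ℝ) {t : ℝ} (ht : 0 < t) :
    σ * ((a : ℂ) ^ 2 / (t : ℂ) ^ (1 + 2 * Complex.I * σ * (a : ℂ) ^ 2))
      = ((σ * a ^ 2 : ℝ) : ℂ) / t * gaugePhase (σ * a ^ 2) t ^ 2 := by
  have ht' : (t : ℂ) ≠ 0 := by exact_mod_cast ht.ne'
  rw [Complex.cpow_add _ _ ht', Complex.cpow_one, Complex.cpow_def_of_ne_zero ht',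
    ← Complex.ofReal_log ht.le, gaugePhase, ← Complex.exp_nat_mul, div_mul_eq_div_div,
    div_eq_mul_inv (_ / _) (Complex.exp _), ← Complex.exp_neg]
  push_cast
  rw [← mul_assoc, ← mul_div_assoc]
  congr 2
  ring

/-- In Fourier variables the weak equation, tested against `𝓕 ψ`, becomes the equation tested
against `ψ`. -/
theorem isLinSolution_iff {σ a t₀ : ℝ} (ht₀ : 0 < t₀) {u : ℝ → L2} :
    IsLinSolution σ a t₀ u ↔ IsFourierSolution (σ * a ^ 2) t₀ (fun t => (𝓕 (u t) : L2)) := by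
  have hF : Continuous fun f : L2 => (𝓕 f : L2) := FourierTransform.continuous_fourier
  have hFi : Continuous fun f : L2 => (𝓕⁻ f : L2) := FourierTransform.continuous_fourierInv
  have key : ∀ (ψ : 𝓢(ℝ, ℂ)) (t : ℝ), t₀ < t → ∀ d : ℂ,
      (Complex.I * d + (∫ x : ℝ, u t x * iteratedDeriv 2 (𝓕 ψ : 𝓢(ℝ, ℂ)) x)
        + σ * ((a : ℂ) ^ 2 / (t : ℂ) ^ (1 + 2 * Complex.I * σ * (a : ℂ) ^ 2))
          * (∫ x : ℝ, (starRingEnd ℂ) (u t x) * (𝓕 ψ : 𝓢(ℝ, ℂ)) x) = 0 ↔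
        d = -(Complex.I * ∫ k, (𝓕 (u t) : L2) k * symbolMul ψ k)
          + Complex.I * (((σ * a ^ 2 : ℝ) : ℂ) / t) * gaugePhase (σ * a ^ 2) t ^ 2
            * ∫ k, reflConj (𝓕 (u t) : L2) k * ψ k) := by
    intro ψ t ht d
    rw [potential_eq σ a (ht₀.trans ht), integral_mul_iteratedDeriv_fourier,
      integral_conj_mul_fourier, integral_reflConj_mul]
    simp only [symbolMul_apply]
    constructor
    · intro h
      linear_combination (-Complex.I) * h + d * Complex.I_sq
    · rintro rfl
      linear_combination (-(∫ k, (𝓕 (u t) : L2) k * (symbolSq k * ψ k)) + ((σ * a ^ 2 : ℝ) : ℂ) / t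
        * gaugePhase (σ * a ^ 2) t ^ 2 * ∫ k, reflConj (𝓕 (u t) : L2) k * ψ k) * Complex.I_sq
  constructor
  · intro h
    refine ⟨hF.comp_continuousOn h.continuousOn, fun ψ t ht => ?_⟩
    obtain ⟨d, hd, he⟩ := h.equation (𝓕 ψ) t ht
    simp only [integral_mul_fourier] at hd
    rwa [(key ψ t ht d).1 he] at hd
  · intro h
    refine ⟨?_, fun φ t ht => ?_⟩
    · have := hFi.comp_continuousOn h.continuousOn
      simpa only [Function.comp_def, FourierTransform.fourierInv_fourier_eq] using this
    · obtain ⟨ψ, rfl⟩ : ∃ ψ : 𝓢(ℝ, ℂ), 𝓕 ψ = φ :=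
        ⟨𝓕⁻ φ, FourierTransform.fourier_fourierInv_eq φ⟩
      refine ⟨_, ?_, (key ψ t ht _).2 rfl⟩
      simp only [integral_mul_fourier]
      exact h.hasDerivAt ψ t ht

/-! ### Uniqueness -/

theorem continuousOn_integral_mul_schwartz {U : ℝ → L2} {s : Set ℝ} (hU : ContinuousOn U s)
    (ψ : 𝓢(ℝ, ℂ)) : ContinuousOn (fun t => ∫ k, U t k * ψ k) s := by
  refine fun t ht => tendsto_iff_norm_sub_tendsto_zero.2 ?_
  have h1 := (tendsto_iff_norm_sub_tendsto_zero.1 (hU t ht)).mul_const ‖(ψ.toLp 2 : L2)‖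
  rw [zero_mul] at h1
  refine squeeze_zero (fun _ => norm_nonneg _) (fun r => ?_) h1
  rw [← integral_sub_mul_schwartz]
  exact norm_integral_mul_schwartz_le _ ψ

theorem IsFourierSolution.sub {κ t₀ : ℝ} {U V : ℝ → L2} (hU : IsFourierSolution κ t₀ U)
    (hV : IsFourierSolution κ t₀ V) : IsFourierSolution κ t₀ (fun t => U t - V t) := by
  refine ⟨hU.continuousOn.sub hV.continuousOn, fun ψ t ht => ?_⟩
  simp only [reflConj_sub, integral_sub_mul_schwartz]
  exact ((hU.hasDerivAt ψ t ht).sub (hV.hasDerivAt ψ t ht)).congr_deriv (by ring)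

/-- A smooth even cutoff, equal to `1` on `[-r, r]` and vanishing outside `[-(r + 1), r + 1]`. -/
noncomputable def cutoff (r : ℝ) (hr : 0 < r) : ContDiffBump (0 : ℝ) := ⟨r, r + 1, hr, by linarith⟩

theorem hasTemperateGrowth_cutoff {r : ℝ} (hr : 0 < r) :
    (fun k : ℝ => (cutoff r hr k : ℂ)).HasTemperateGrowth := by
  have h1 : HasCompactSupport fun k : ℝ => (cutoff r hr k : ℂ) :=
    (cutoff r hr).hasCompactSupport.comp_left (g := fun x : ℝ => (x : ℂ)) Complex.ofReal_zero
  have h2 : ContDiff ℝ ((⊤ : ℕ∞) : WithTop ℕ∞) fun k : ℝ => (cutoff r hr k : ℂ) :=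
    Complex.ofRealCLM.contDiff.comp (cutoff r hr).contDiff
  exact (h1.toSchwartzMap h2).hasTemperateGrowth

theorem norm_cutoff_le {r : ℝ} (hr : 0 < r) (k : ℝ) : ‖(cutoff r hr k : ℂ)‖ ≤ 1 := by
  rw [Complex.norm_real, Real.norm_eq_abs, abs_of_nonneg (cutoff r hr).nonneg]
  exact (cutoff r hr).le_one

theorem continuous_cutoff {r : ℝ} (hr : 0 < r) : Continuous fun k : ℝ => (cutoff r hr k : ℂ) :=
  Complex.continuous_ofReal.comp (cutoff r hr).continuous

theorem coeFn_mulL2_cutoff {r : ℝ} (hr : 0 < r) (g : L2) :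
    mulL2 (fun k => (cutoff r hr k : ℂ)) g =ᵐ[volume] fun k => (cutoff r hr k : ℂ) * g k :=
  coeFn_mulL2 (continuous_cutoff hr).aestronglyMeasurable
    (Eventually.of_forall (norm_cutoff_le hr)) g

theorem norm_mulL2_cutoff_le {r : ℝ} (hr : 0 < r) (g : L2) :
    ‖mulL2 (fun k => (cutoff r hr k : ℂ)) g‖ ≤ ‖g‖ := by
  refine Lp.norm_le_norm_of_ae_le ?_
  filter_upwards [coeFn_mulL2_cutoff hr g] with k hk
  rw [hk, norm_mul]
  exact mul_le_of_le_one_left (norm_nonneg _) (norm_cutoff_le hr k)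

theorem integral_mul_cutoff_mul {r : ℝ} (hr : 0 < r) (g : L2) (φ : 𝓢(ℝ, ℂ)) :
    ∫ k, g k * SchwartzMap.smulLeftCLM ℂ (fun k => (cutoff r hr k : ℂ)) φ k
      = ∫ k, mulL2 (fun k => (cutoff r hr k : ℂ)) g k * φ k := by
  refine integral_congr_ae ?_
  filter_upwards [coeFn_mulL2_cutoff hr g] with k hk
  rw [hk, SchwartzMap.smulLeftCLM_apply_apply (hasTemperateGrowth_cutoff hr), smul_eq_mul]
  ring

theorem reflConj_mulL2_cutoff {r : ℝ} (hr : 0 < r) (g : L2) :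
    reflConj (mulL2 (fun k => (cutoff r hr k : ℂ)) g)
      = mulL2 (fun k => (cutoff r hr k : ℂ)) (reflConj g) := by
  refine Lp.ext ?_
  filter_upwards [coeFn_reflConj (mulL2 (fun k => (cutoff r hr k : ℂ)) g), coeFn_reflConj g,
    coeFn_mulL2_cutoff hr (reflConj g), ae_neg_of_ae (coeFn_mulL2_cutoff hr g)] with k h1 h2 h3 h4
  rw [h1, h4, h3, h2, map_mul, Complex.conj_ofReal, ContDiffBump.neg]

/-- On the support of the cutoff the symbol is bounded. -/
theorem norm_integral_symbolMul_cutoff_le {r : ℝ} (hr : 0 < r) (g : L2) (φ : 𝓢(ℝ, ℂ)) :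
    ‖∫ k, g k * symbolMul (SchwartzMap.smulLeftCLM ℂ (fun k => (cutoff r hr k : ℂ)) φ) k‖
      ≤ symbolSq (r + 1) * ‖mulL2 (fun k => (cutoff r hr k : ℂ)) g‖ * ‖(φ.toLp 2 : L2)‖ := by
  set c : ℝ → ℂ := fun k => symbolSq k * cutoff r hr k with hc
  have hcb : ∀ k, ‖c k‖ ≤ symbolSq (r + 1) * ‖(cutoff r hr k : ℂ)‖ := by
    intro k
    rw [hc]
    by_cases hk : |k| < r + 1
    · simp only [norm_mul]
      gcongr
      rw [Complex.norm_real, Real.norm_eq_abs, symbolSq, symbolSq, abs_of_nonneg (sq_nonneg _),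
        sq_le_sq, abs_mul, abs_mul _ (r + 1)]
      exact mul_le_mul_of_nonneg_left (hk.le.trans (le_abs_self _)) (abs_nonneg _)
    · have : cutoff r hr k = 0 := by
        refine (cutoff r hr).zero_of_le_dist ?_
        rw [Real.dist_eq, sub_zero]
        exact not_lt.1 hk
      simp [this]
  have h0 : 0 ≤ symbolSq (r + 1) := sq_nonneg _
  have hcb' : ∀ k, ‖c k‖ ≤ symbolSq (r + 1) := fun k =>
    (hcb k).trans (mul_le_of_le_one_right h0 (norm_cutoff_le hr k))
  have hcm : AEStronglyMeasurable c volume :=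
    ((Complex.continuous_ofReal.comp continuous_symbolSq).mul
      (continuous_cutoff hr)).aestronglyMeasurable
  have hcoe := coeFn_mulL2 hcm (Eventually.of_forall hcb') g
  have e : ∫ k, g k * symbolMul (SchwartzMap.smulLeftCLM ℂ (fun k => (cutoff r hr k : ℂ)) φ) k
      = ∫ k, mulL2 c g k * φ k := by
    refine integral_congr_ae ?_
    filter_upwards [hcoe] with k hk
    rw [hk, symbolMul_apply, SchwartzMap.smulLeftCLM_apply_apply (hasTemperateGrowth_cutoff hr),
      smul_eq_mul, hc]
    ring
  rw [e]
  refine (norm_integral_mul_schwartz_le _ φ).trans ?_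
  gcongr
  refine Lp.norm_le_mul_norm_of_ae_le_mul ?_
  filter_upwards [hcoe, coeFn_mulL2_cutoff hr g] with k h1 h2
  rw [h1, h2, norm_mul (c k), norm_mul (cutoff r hr k : ℂ), ← mul_assoc]
  exact mul_le_mul_of_nonneg_right (hcb k) (norm_nonneg _)

/-- One step of the Gronwall iteration for the frequency-truncated solution, on which the
generator is bounded. -/
theorem IsFourierSolution.norm_cutoff_le_half {κ t₀ T r B L : ℝ} {U : ℝ → L2} (ht₀ : 0 < t₀)
    (hU : IsFourierSolution κ t₀ U) (h0 : U t₀ = 0) (hr : 0 < r) (hB : 0 ≤ B)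
    (hL : L = symbolSq (r + 1) + |κ| / t₀)
    (h : ∀ t ∈ Icc t₀ T, ‖mulL2 (fun k => (cutoff r hr k : ℂ)) (U t)‖
      ≤ B * Real.exp (2 * L * (t - t₀))) :
    ∀ t ∈ Icc t₀ T, ‖mulL2 (fun k => (cutoff r hr k : ℂ)) (U t)‖
      ≤ B / 2 * Real.exp (2 * L * (t - t₀)) := by
  intro t ht
  refine norm_le_of_forall_schwartz (fun φ => ?_) (by positivity)
  set ψ := SchwartzMap.smulLeftCLM ℂ (fun k => (cutoff r hr k : ℂ)) φ with hψ
  rw [← integral_mul_cutoff_mul, ← hψ]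
  set N := ‖(φ.toLp 2 : L2)‖ with hN
  set f : ℝ → ℂ := fun s => ∫ k, U s k * ψ k with hf
  have hfc : ContinuousOn f (Ici t₀) := continuousOn_integral_mul_schwartz hU.continuousOn ψ
  have hf0 : f t₀ = 0 := by
    rw [hf]
    simp only [h0]
    rw [← integral_zero ℝ ℂ]
    refine integral_congr_ae ?_
    filter_upwards [Lp.coeFn_zero ℂ 2 (volume : Measure ℝ)] with k hk
    rw [hk, Pi.zero_apply, zero_mul]
  have hderiv : ∀ s, t₀ < s → s ≤ T →
      ‖-(Complex.I * ∫ k, U s k * symbolMul ψ k) + Complex.I * (κ / s) * gaugePhase κ s ^ 2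
        * ∫ k, reflConj (U s) k * ψ k‖ ≤ L * (B * Real.exp (2 * L * (s - t₀))) * N := by
    intro s hs hsT
    have hs0 : 0 < s := ht₀.trans hs
    have b1 := norm_integral_symbolMul_cutoff_le hr (U s) φ
    have b2 : ‖∫ k, reflConj (U s) k * ψ k‖
        ≤ ‖mulL2 (fun k => (cutoff r hr k : ℂ)) (U s)‖ * N := by
      rw [hψ, integral_mul_cutoff_mul, ← reflConj_mulL2_cutoff, ← norm_reflConj]
      exact norm_integral_mul_schwartz_le _ φ
    have b3 := h s ⟨hs.le, hsT⟩
    set H := ‖mulL2 (fun k => (cutoff r hr k : ℂ)) (U s)‖ with hH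
    have b4 : |κ| / s ≤ |κ| / t₀ := by gcongr
    have hsym : 0 ≤ symbolSq (r + 1) := sq_nonneg _
    have hH0 : 0 ≤ H := norm_nonneg _
    have hN0 : 0 ≤ N := norm_nonneg _
    calc _ ≤ symbolSq (r + 1) * H * N + |κ| / s * (H * N) := by
          refine (norm_add_le _ _).trans (add_le_add ?_ ?_)
          · rw [norm_neg, norm_mul, Complex.norm_I, one_mul]
            exact b1
          · rw [norm_mul, norm_mul, norm_mul, Complex.norm_I, one_mul, norm_pow, norm_gaugePhase,
              one_pow, mul_one, norm_div, Complex.norm_real, Complex.norm_real, Real.norm_eq_abs,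
              Real.norm_eq_abs, abs_of_pos hs0]
            gcongr
      _ ≤ symbolSq (r + 1) * H * N + |κ| / t₀ * (H * N) := by gcongr
      _ = L * H * N := by rw [hL]; ring
      _ ≤ _ := by
        have : 0 ≤ L := by rw [hL]; positivity
        gcongr
  have hBd : ∀ s, HasDerivAt (fun s => B / 2 * Real.exp (2 * L * (s - t₀)) * N)
      (L * (B * Real.exp (2 * L * (s - t₀))) * N) s := fun s => by
    refine ((((((hasDerivAt_id s).sub_const t₀).const_mul (2 * L)).exp).const_mul
      (B / 2)).mul_const N).congr_deriv ?_
    simp only [id_eq]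
    ring
  have hstep : ∀ s, t₀ < s → s ≤ t →
      ‖f t - f s‖ ≤ B / 2 * Real.exp (2 * L * (t - t₀)) * N := by
    intro s hs hst
    refine image_norm_le_of_norm_deriv_right_le_deriv_boundary' (f := fun τ => f τ - f s)
      (a := s) (b := t) (B := fun s => B / 2 * Real.exp (2 * L * (s - t₀)) * N)
      (fun τ hτ => ((hU.hasDerivAt ψ τ (hs.trans_le hτ.1)).sub_const
        _).continuousAt.continuousWithinAt)
      (fun τ hτ => ((hU.hasDerivAt ψ τ (hs.trans_le hτ.1)).sub_const _).hasDerivWithinAt)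
      (by rw [sub_self, norm_zero]; positivity)
      (fun τ hτ => (hBd τ).continuousAt.continuousWithinAt)
      (fun τ hτ => (hBd τ).hasDerivWithinAt)
      (fun τ hτ => hderiv τ (hs.trans_le hτ.1) (hτ.2.le.trans ht.2)) (right_mem_Icc.2 hst)
  -- The equation holds only for `t > t₀`: start at `s > t₀` and let `s → t₀`.
  change ‖f t‖ ≤ _
  rcases ht.1.eq_or_lt with h1 | h1
  · rw [← h1, hf0, norm_zero]; positivity
  · have hlim : Tendsto (fun s => ‖f t - f s‖) (𝓝[>] t₀) (𝓝 ‖f t - f t₀‖) :=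
      (tendsto_const_nhds.sub ((hfc t₀ self_mem_Ici).mono_left
        (nhdsWithin_mono _ Ioi_subset_Ici_self))).norm
    rw [hf0, sub_zero] at hlim
    refine le_of_tendsto hlim ?_
    filter_upwards [Ioo_mem_nhdsGT h1] with s hs using hstep s hs.1 hs.2.le

/-- Each frequency-truncated part of the solution is bounded on compact time intervals; iterating the
step of the Gronwall estimate shows that it vanishes. -/
theorem IsFourierSolution.eq_zero {κ t₀ : ℝ} {U : ℝ → L2} (ht₀ : 0 < t₀)
    (hU : IsFourierSolution κ t₀ U) (h0 : U t₀ = 0) {t : ℝ} (ht : t₀ ≤ t) : U t = 0 := by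
  have hcut : ∀ (r : ℝ) (hr : 0 < r), mulL2 (fun k => (cutoff r hr k : ℂ)) (U t) = 0 := by
    intro r hr
    set L := symbolSq (r + 1) + |κ| / t₀ with hL
    have hL0 : 0 ≤ L := by
      have : 0 ≤ symbolSq (r + 1) := sq_nonneg _
      positivity
    obtain ⟨B, hB⟩ := isCompact_Icc.exists_bound_of_continuousOn
      (hU.continuousOn.mono (Icc_subset_Ici_self : Icc t₀ t ⊆ Ici t₀))
    have hB0 : 0 ≤ B := (norm_nonneg _).trans (hB t ⟨ht, le_rfl⟩)
    have hiter : ∀ n : ℕ, ∀ s ∈ Icc t₀ t, ‖mulL2 (fun k => (cutoff r hr k : ℂ)) (U s)‖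
        ≤ B / 2 ^ n * Real.exp (2 * L * (s - t₀)) := by
      intro n
      induction n with
      | zero =>
        intro s hs
        rw [pow_zero, div_one]
        refine (norm_mulL2_cutoff_le hr _).trans ((hB s hs).trans ?_)
        refine le_mul_of_one_le_right hB0 (Real.one_le_exp ?_)
        have := hs.1
        have : 0 ≤ s - t₀ := by linarith
        positivity
      | succ n ih =>
        rw [pow_succ, ← div_div]
        exact hU.norm_cutoff_le_half ht₀ h0 hr (by positivity) hL ih
    have hlim : Tendsto (fun n : ℕ => B / 2 ^ n * Real.exp (2 * L * (t - t₀))) atTop (𝓝 0) := by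
      have := (tendsto_pow_atTop_nhds_zero_of_lt_one (r := (1 / 2 : ℝ)) (by norm_num)
        (by norm_num)).const_mul (B * Real.exp (2 * L * (t - t₀)))
      rw [mul_zero] at this
      refine this.congr fun n => ?_
      rw [one_div, inv_pow]
      ring
    have := ge_of_tendsto' hlim fun n => hiter n t ⟨ht, le_rfl⟩
    exact norm_le_zero_iff.1 this
  refine Lp.ext ?_
  have hae : ∀ᵐ k, ∀ n : ℕ, (cutoff (n + 1) n.cast_add_one_pos k : ℂ) * U t k = 0 := by
    rw [ae_all_iff]
    intro n
    have h1 := coeFn_mulL2_cutoff n.cast_add_one_pos (U t)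
    rw [hcut] at h1
    filter_upwards [h1, Lp.coeFn_zero ℂ 2 (volume : Measure ℝ)] with k h1 h2
    rw [← h1, h2, Pi.zero_apply]
  filter_upwards [hae, Lp.coeFn_zero ℂ 2 (volume : Measure ℝ)] with k h1 h2
  rw [h2, Pi.zero_apply]
  obtain ⟨n, hn⟩ := exists_nat_ge |k|
  have hone : cutoff ((n : ℝ) + 1) n.cast_add_one_pos k = 1 := by
    refine (cutoff _ _).one_of_mem_closedBall ?_
    rw [mem_closedBall_zero_iff, Real.norm_eq_abs]
    exact hn.trans (by simp [cutoff])
  have := h1 n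
  rwa [hone, Complex.ofReal_one, one_mul] at this

/-- Uniqueness holds in `C([t₀, ∞); L²)`, without any condition at low frequency. -/
theorem IsLinSolution.eqOn {σ a t₀ : ℝ} {u v : ℝ → L2} (ht₀ : 0 < t₀)
    (hu : IsLinSolution σ a t₀ u) (hv : IsLinSolution σ a t₀ v) (h : u t₀ = v t₀) :
    EqOn u v (Ici t₀) := by
  intro t ht
  have hd := ((isLinSolution_iff ht₀).1 hu).sub ((isLinSolution_iff ht₀).1 hv)
  have h1 := hd.eq_zero ht₀ (by simp only [h, sub_self]) ht
  have h2 := congrArg (fun f : L2 => (𝓕⁻ f : L2)) (sub_eq_zero.1 h1)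
  simpa only [FourierTransform.fourierInv_fourier_eq] using h2

/-! ### Existence -/

theorem norm_sq_eq_integral (f : L2) : ‖f‖ ^ 2 = ∫ x, ‖f x‖ ^ 2 := by
  have h : inner ℂ f f = ∫ x, ((‖f x‖ ^ 2 : ℝ) : ℂ) := by
    rw [L2.inner_def]
    refine integral_congr_ae (Eventually.of_forall fun x => ?_)
    simp only [inner_self_eq_norm_sq_to_K]
    push_cast
    rfl
  rw [inner_self_eq_norm_sq_to_K, integral_complex_ofReal] at h
  refine Complex.ofReal_injective ?_
  rw [Complex.ofReal_pow]
  exact h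

/-- Continuity of `t ↦ c(t, ·) g` in `L²`, by dominated convergence. -/
theorem continuousOn_mulL2 {c : ℝ → ℝ → ℂ} {s : Set ℝ} (g : L2)
    (hm : ∀ t ∈ s, AEStronglyMeasurable (c t) volume)
    (hb : ∀ T ∈ s, ∃ C : ℝ, ∀ᶠ t in 𝓝[s] T, ∀ᵐ k, ‖c t k‖ ≤ C)
    (hc : ∀ T ∈ s, ∀ᵐ k, ContinuousWithinAt (fun t => c t k) s T) :
    ContinuousOn (fun t => mulL2 (c t) g) s := by
  intro T hT
  obtain ⟨C, hC⟩ := hb T hT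
  have hCT : ∀ᵐ k, ‖c T k‖ ≤ C := hC.self_of_nhdsWithin hT
  refine tendsto_iff_norm_sub_tendsto_zero.2 ?_
  have key : Tendsto (fun t => ∫ k, ‖(mulL2 (c t) g - mulL2 (c T) g : L2) k‖ ^ 2) (𝓝[s] T)
      (𝓝 (∫ _ : ℝ, (0 : ℝ))) := by
    have hcongr : ∀ᶠ t in 𝓝[s] T, ∫ k, ‖(c t k - c T k) * g k‖ ^ 2
        = ∫ k, ‖(mulL2 (c t) g - mulL2 (c T) g : L2) k‖ ^ 2 := by
      filter_upwards [hC, self_mem_nhdsWithin] with t ht hts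
      refine integral_congr_ae ?_
      filter_upwards [coeFn_mulL2 (hm t hts) ht g, coeFn_mulL2 (hm T hT) hCT g,
        Lp.coeFn_sub (mulL2 (c t) g) (mulL2 (c T) g)] with k h1 h2 h3
      rw [h3, Pi.sub_apply, h1, h2, sub_mul]
    refine Tendsto.congr' hcongr ?_
    refine tendsto_integral_filter_of_dominated_convergence (fun k => (2 * C) ^ 2 * ‖g k‖ ^ 2)
      ?_ ?_ ?_ ?_
    · filter_upwards [self_mem_nhdsWithin] with t hts
      exact ((((hm t hts).sub (hm T hT)).mul (Lp.aestronglyMeasurable g)).norm.pow 2)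
    · filter_upwards [hC] with t ht
      filter_upwards [ht, hCT] with k h1 h2
      rw [Real.norm_eq_abs, abs_of_nonneg (sq_nonneg _), ← mul_pow]
      gcongr
      rw [norm_mul]
      gcongr
      exact (norm_sub_le _ _).trans (by linarith)
    · exact ((Lp.memLp g).integrable_norm_pow two_ne_zero).const_mul _
    · filter_upwards [hc T hT] with k hk
      have h1 : Tendsto (fun t => ‖(c t k - c T k) * g k‖ ^ 2) (𝓝[s] T)
          (𝓝 (‖(c T k - c T k) * g k‖ ^ 2)) :=
        (((Tendsto.sub hk tendsto_const_nhds).mul_const _).norm).pow 2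
      simpa using h1
  simp only [← norm_sq_eq_integral, integral_zero] at key
  have := key.sqrt
  simpa only [Real.sqrt_sq (norm_nonneg _), Real.sqrt_zero] using this

theorem ae_ne_zero : ∀ᵐ k : ℝ, k ≠ 0 := by
  rw [ae_iff]
  simp

theorem aestronglyMeasurable_comp_symbolSq {c : ℝ → ℂ} (hc : ContinuousOn c (Ioi 0)) :
    AEStronglyMeasurable (fun k => c (symbolSq k)) volume := by
  have h1 : ContinuousOn (fun k => c (symbolSq k)) {0}ᶜ :=
    hc.comp continuous_symbolSq.continuousOn fun k hk => symbolSq_pos hk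
  have h2 := h1.aestronglyMeasurable (μ := volume) (measurableSet_singleton 0).compl
  rwa [Measure.restrict_eq_self_of_ae_mem (by simpa using ae_ne_zero)] at h2

/-- The solution on the Fourier side with datum `F` at time `t₀`, assembled from the modes. -/
noncomputable def modeSolution (κ t₀ : ℝ) (F : L2) (t : ℝ) : L2 :=
  mulL2 (fun k => modeDirect κ t₀ (symbolSq k) t) F
    + mulL2 (fun k => modeConj κ t₀ (symbolSq k) t) (reflConj F)

section

variable {κ t₀ : ℝ}

theorem aestronglyMeasurable_modeDirect (ht₀ : 0 < t₀) {t : ℝ} (ht : t₀ ≤ t) :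
    AEStronglyMeasurable (fun k => modeDirect κ t₀ (symbolSq k) t) volume :=
  aestronglyMeasurable_comp_symbolSq (continuousOn_modeDirect κ ht₀ (ht₀.trans_le ht))

theorem aestronglyMeasurable_modeConj (ht₀ : 0 < t₀) {t : ℝ} (ht : t₀ ≤ t) :
    AEStronglyMeasurable (fun k => modeConj κ t₀ (symbolSq k) t) volume :=
  aestronglyMeasurable_comp_symbolSq (continuousOn_modeConj κ ht₀ (ht₀.trans_le ht))

theorem norm_mode_le_of_le (ht₀ : 0 < t₀) {t T k : ℝ} (ht : t₀ ≤ t) (htT : t ≤ T) (hk : k ≠ 0) :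
    ‖modeDirect κ t₀ (symbolSq k) t‖ ≤ (T / t₀) ^ |κ| ∧
      ‖modeConj κ t₀ (symbolSq k) t‖ ≤ (T / t₀) ^ |κ| := by
  have h := norm_mode_le_rpow κ ht₀ (symbolSq_pos hk) ht
  have h1 : (t / t₀) ^ |κ| ≤ (T / t₀) ^ |κ| := by
    have : 0 ≤ t / t₀ := div_nonneg (ht₀.le.trans ht) ht₀.le
    gcongr
  exact ⟨h.1.trans h1, h.2.trans h1⟩

theorem coeFn_modeSolution (ht₀ : 0 < t₀) (F : L2) {t : ℝ} (ht : t₀ ≤ t) :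
    modeSolution κ t₀ F t =ᵐ[volume] fun k => modeDirect κ t₀ (symbolSq k) t * F k
      + modeConj κ t₀ (symbolSq k) t * reflConj F k := by
  have b1 : ∀ᵐ k : ℝ, ‖modeDirect κ t₀ (symbolSq k) t‖ ≤ (t / t₀) ^ |κ| :=
    ae_ne_zero.mono fun k hk => (norm_mode_le_of_le ht₀ ht le_rfl hk).1
  have b2 : ∀ᵐ k : ℝ, ‖modeConj κ t₀ (symbolSq k) t‖ ≤ (t / t₀) ^ |κ| :=
    ae_ne_zero.mono fun k hk => (norm_mode_le_of_le ht₀ ht le_rfl hk).2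
  filter_upwards [coeFn_mulL2 (aestronglyMeasurable_modeDirect ht₀ ht) b1 F,
    coeFn_mulL2 (aestronglyMeasurable_modeConj ht₀ ht) b2 (reflConj F),
    Lp.coeFn_add (mulL2 (fun k => modeDirect κ t₀ (symbolSq k) t) F)
      (mulL2 (fun k => modeConj κ t₀ (symbolSq k) t) (reflConj F))] with k h1 h2 h3
  rw [modeSolution, h3, Pi.add_apply, h1, h2]

theorem coeFn_reflConj_modeSolution (ht₀ : 0 < t₀) (F : L2) {t : ℝ} (ht : t₀ ≤ t) :
    reflConj (modeSolution κ t₀ F t) =ᵐ[volume] fun k =>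
      starRingEnd ℂ (modeDirect κ t₀ (symbolSq k) t) * reflConj F k
        + starRingEnd ℂ (modeConj κ t₀ (symbolSq k) t) * F k := by
  filter_upwards [coeFn_reflConj (modeSolution κ t₀ F t),
    ae_neg_of_ae (coeFn_modeSolution (κ := κ) ht₀ F ht), coeFn_reflConj F,
    ae_neg_of_ae (coeFn_reflConj F)] with k h1 h2 h3 h4
  rw [h1, h2, map_add, map_mul, map_mul, symbolSq_neg, h4, h3, Complex.conj_conj, neg_neg]

theorem modeSolution_self (ht₀ : 0 < t₀) (F : L2) : modeSolution κ t₀ F t₀ = F := by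
  refine Lp.ext ?_
  filter_upwards [coeFn_modeSolution (κ := κ) ht₀ F le_rfl, ae_ne_zero] with k h1 hk
  rw [h1, modeDirect_self κ ht₀ (symbolSq_pos hk), modeConj_self κ ht₀ (symbolSq_pos hk), one_mul,
    zero_mul, add_zero]

theorem continuousOn_modeSolution (ht₀ : 0 < t₀) (F : L2) :
    ContinuousOn (modeSolution κ t₀ F) (Ici t₀) := by
  have hnear : ∀ T ∈ Ici t₀, ∀ᶠ t in 𝓝[Ici t₀] T, t₀ ≤ t ∧ t ≤ T + 1 := fun T _ => by
    filter_upwards [self_mem_nhdsWithin, mem_nhdsWithin_of_mem_nhds (Iic_mem_nhds (lt_add_one T))]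
      with t h1 h2 using ⟨h1, h2⟩
  refine (continuousOn_mulL2 F (fun t ht => aestronglyMeasurable_modeDirect ht₀ ht)
    (fun T hT => ⟨((T + 1) / t₀) ^ |κ|, ?_⟩) fun T hT => ?_).add
    (continuousOn_mulL2 (reflConj F) (fun t ht => aestronglyMeasurable_modeConj ht₀ ht)
    (fun T hT => ⟨((T + 1) / t₀) ^ |κ|, ?_⟩) fun T hT => ?_)
  · filter_upwards [hnear T hT] with t ht
    exact ae_ne_zero.mono fun k hk => (norm_mode_le_of_le ht₀ ht.1 ht.2 hk).1
  · exact ae_ne_zero.mono fun k hk => (hasDerivAt_modeDirect κ t₀ (symbolSq_pos hk)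
      (ht₀.trans_le hT)).continuousAt.continuousWithinAt
  · filter_upwards [hnear T hT] with t ht
    exact ae_ne_zero.mono fun k hk => (norm_mode_le_of_le ht₀ ht.1 ht.2 hk).2
  · exact ae_ne_zero.mono fun k hk => (hasDerivAt_modeConj κ t₀ (symbolSq_pos hk)
      (ht₀.trans_le hT)).continuousAt.continuousWithinAt

theorem isFourierSolution_modeSolution (ht₀ : 0 < t₀) (F : L2) :
    IsFourierSolution κ t₀ (modeSolution κ t₀ F) := by
  refine ⟨continuousOn_modeSolution ht₀ F, fun ψ t ht => ?_⟩
  set G := reflConj F with hG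
  have ht0 : 0 < t := ht₀.trans ht
  set Φ : ℝ → ℝ → ℂ := fun s k => (modeDirect κ t₀ (symbolSq k) s * F k
    + modeConj κ t₀ (symbolSq k) s * G k) * ψ k with hΦ
  set Φ' : ℝ → ℝ → ℂ := fun s k =>
    -(Complex.I * ((modeDirect κ t₀ (symbolSq k) s * F k
      + modeConj κ t₀ (symbolSq k) s * G k) * symbolMul ψ k))
    + Complex.I * (κ / s) * gaugePhase κ s ^ 2 *
      ((starRingEnd ℂ (modeDirect κ t₀ (symbolSq k) s) * G k
        + starRingEnd ℂ (modeConj κ t₀ (symbolSq k) s) * F k) * ψ k) with hΦ'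
  have hΦint : ∀ s, t₀ ≤ s → ∫ k, modeSolution κ t₀ F s k * ψ k = ∫ k, Φ s k := fun s hs => by
    refine integral_congr_ae ?_
    filter_upwards [coeFn_modeSolution (κ := κ) ht₀ F hs] with k hk
    rw [hk]
  have hmeas : ∀ s, t₀ ≤ s → AEStronglyMeasurable (Φ s) volume := fun s hs =>
    (((aestronglyMeasurable_modeDirect ht₀ hs).mul (Lp.aestronglyMeasurable F)).add
      ((aestronglyMeasurable_modeConj ht₀ hs).mul (Lp.aestronglyMeasurable G))).mul
      ψ.continuous.aestronglyMeasurable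
  have hint : Integrable (Φ t) := by
    refine (integrable_mul_schwartz (modeSolution κ t₀ F t) ψ).congr ?_
    filter_upwards [coeFn_modeSolution (κ := κ) ht₀ F ht.le] with k hk
    rw [hk]
  have hI1 : Integrable fun k => -(Complex.I * (modeSolution κ t₀ F t k * symbolMul ψ k)) :=
    ((integrable_mul_schwartz _ (symbolMul ψ)).const_mul _).neg
  have hI2 : Integrable fun k => Complex.I * (κ / t) * gaugePhase κ t ^ 2 *
      (reflConj (modeSolution κ t₀ F t) k * ψ k) :=
    (integrable_mul_schwartz _ ψ).const_mul _
  have hΦ'ae : (fun k => -(Complex.I * (modeSolution κ t₀ F t k * symbolMul ψ k))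
      + Complex.I * (κ / t) * gaugePhase κ t ^ 2 *
        (reflConj (modeSolution κ t₀ F t) k * ψ k)) =ᵐ[volume] Φ' t := by
    filter_upwards [coeFn_modeSolution (κ := κ) ht₀ F ht.le,
      coeFn_reflConj_modeSolution (κ := κ) ht₀ F ht.le] with k h1 h2
    rw [h1, h2]
  have hΦ'int : ∫ k, Φ' t k = -(Complex.I * ∫ k, modeSolution κ t₀ F t k * symbolMul ψ k)
      + Complex.I * (κ / t) * gaugePhase κ t ^ 2
        * ∫ k, reflConj (modeSolution κ t₀ F t) k * ψ k := by
    rw [← integral_congr_ae hΦ'ae, integral_add hI1 hI2, integral_neg, integral_const_mul,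
      integral_const_mul]
  set A : ℝ := ((t + 1) / t₀) ^ |κ| with hA
  have hA0 : 0 ≤ A := by positivity
  set bound : ℝ → ℝ := fun k => A * (‖F k * symbolMul ψ k‖ + ‖G k * symbolMul ψ k‖)
    + |κ| / t₀ * (A * (‖G k * ψ k‖ + ‖F k * ψ k‖)) with hbound
  have hboundint : Integrable bound :=
    (((integrable_mul_schwartz F (symbolMul ψ)).norm.add
      (integrable_mul_schwartz G (symbolMul ψ)).norm).const_mul A).add
    ((((integrable_mul_schwartz G ψ).norm.add
      (integrable_mul_schwartz F ψ).norm).const_mul A).const_mul _)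
  have hnhds : Ioo t₀ (t + 1) ∈ 𝓝 t := Ioo_mem_nhds ht (lt_add_one t)
  have hmain := (hasDerivAt_integral_of_dominated_loc_of_deriv_le (F := Φ) (F' := Φ')
    (bound := bound) (μ := volume) (s := Ioo t₀ (t + 1)) hnhds
    (by filter_upwards [hnhds] with s hs using hmeas s hs.1.le) hint
    ((hI1.add hI2).aestronglyMeasurable.congr hΦ'ae) ?_ hboundint ?_).2
  · rw [hΦ'int] at hmain
    refine hmain.congr_of_eventuallyEq ?_
    filter_upwards [hnhds] with s hs using hΦint s hs.1.le
  · filter_upwards [ae_ne_zero] with k hk s hs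
    have hs0 : 0 < s := ht₀.trans hs.1
    obtain ⟨n1, n2⟩ := norm_mode_le_of_le (κ := κ) ht₀ hs.1.le hs.2.le hk
    rw [← hA] at n1 n2
    simp only [hΦ', hbound]
    refine (norm_add_le _ _).trans (add_le_add ?_ ?_)
    · rw [norm_neg, norm_mul, Complex.norm_I, one_mul, add_mul, mul_add, mul_assoc, mul_assoc]
      refine (norm_add_le _ _).trans (add_le_add ?_ ?_)
      · rw [norm_mul]; gcongr
      · rw [norm_mul]; gcongr
    · rw [norm_mul, norm_mul, norm_mul, Complex.norm_I, one_mul, norm_pow, norm_gaugePhase,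
        one_pow, mul_one, norm_div, Complex.norm_real, Complex.norm_real, Real.norm_eq_abs,
        Real.norm_eq_abs, abs_of_pos hs0]
      have hκs : |κ| / s ≤ |κ| / t₀ := by
        have := hs.1.le
        gcongr
      refine mul_le_mul hκs ?_ (norm_nonneg _) (by positivity)
      rw [add_mul, mul_add, mul_assoc, mul_assoc]
      refine (norm_add_le _ _).trans (add_le_add ?_ ?_)
      · rw [norm_mul, RCLike.norm_conj]; gcongr
      · rw [norm_mul, RCLike.norm_conj]; gcongr
  · filter_upwards [ae_ne_zero] with k hk s hs
    have hs0 : 0 < s := ht₀.trans hs.1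
    have d1 := hasDerivAt_modeDirect κ t₀ (symbolSq_pos hk) hs0
    have d2 := hasDerivAt_modeConj κ t₀ (symbolSq_pos hk) hs0
    refine (((d1.mul_const (F k)).add (d2.mul_const (G k))).mul_const (ψ k)).congr_deriv ?_
    simp only [hΦ', symbolMul_apply]
    ring

end

/-! ### The low-frequency norm -/

theorem ae_comp_mul_left {p : ℝ → Prop} {c : ℝ} (hc : c ≠ 0) (h : ∀ᵐ x : ℝ, p x) :
    ∀ᵐ x : ℝ, p (c * x) := by
  have hq : Measure.QuasiMeasurePreserving (fun x : ℝ => c * x) volume volume :=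
    ⟨measurable_const_mul c, by
      rw [Real.map_volume_mul_left hc]
      exact Measure.smul_absolutelyContinuous⟩
  exact hq.ae h

theorem symbolSq_rpow (γ k : ℝ) : symbolSq k ^ γ = |2 * Real.pi * k| ^ (2 * γ) := by
  rw [symbolSq, ← sq_abs, ← Real.rpow_natCast, ← Real.rpow_mul (abs_nonneg _)]
  norm_num

/-- The low-frequency norm in terms of Mathlib's Fourier transform, after `ξ = 2πk`. -/
theorem lowFreqNorm_le_ofReal_iff {γ B : ℝ} (hB : 0 ≤ B) {f : L2} :
    lowFreqNorm γ f ≤ ENNReal.ofReal B ↔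
      ∀ᵐ k : ℝ, symbolSq k ≤ 1 → symbolSq k ^ γ * ‖(𝓕 f : L2) k‖ ≤ B := by
  have hset : MeasurableSet {ξ : ℝ | ξ ^ 2 ≤ 1} :=
    measurableSet_le (by fun_prop) measurable_const
  have h2π : 2 * Real.pi ≠ 0 := by positivity
  have h1 : lowFreqNorm γ f ≤ ENNReal.ofReal B ↔ ∀ᵐ ξ : ℝ, ξ ^ 2 ≤ 1 →
      |ξ| ^ (2 * γ) * ‖(𝓕 f : L2) (ξ / (2 * Real.pi))‖ ≤ B := by
    have hnorm : ∀ ξ : ℝ, ‖((|ξ| ^ (2 * γ) : ℝ) : ℂ) * angularFourier f ξ‖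
        = |ξ| ^ (2 * γ) * ‖(𝓕 f : L2) (ξ / (2 * Real.pi))‖ := fun ξ => by
      rw [norm_mul, Complex.norm_real, Real.norm_eq_abs, abs_of_nonneg (by positivity),
        angularFourier]
    rw [lowFreqNorm, eLpNorm_exponent_top]
    constructor
    · intro h
      have := ae_le_eLpNormEssSup (μ := volume.restrict {ξ : ℝ | ξ ^ 2 ≤ 1})
        (f := fun ξ : ℝ => ((|ξ| ^ (2 * γ) : ℝ) : ℂ) * angularFourier f ξ)
      rw [ae_restrict_iff' hset] at this
      filter_upwards [this] with ξ hξ hξ1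
      rw [← hnorm, ← ENNReal.ofReal_le_ofReal_iff hB, ofReal_norm]
      exact (hξ hξ1).trans h
    · intro h
      refine eLpNormEssSup_le_of_ae_bound ?_
      rw [ae_restrict_iff' hset]
      filter_upwards [h] with ξ hξ hξ1
      rw [hnorm]
      exact hξ hξ1
  rw [h1]
  constructor
  · intro h
    filter_upwards [ae_comp_mul_left h2π h] with k hk hk1
    rw [mul_div_cancel_left₀ _ h2π] at hk
    rw [symbolSq_rpow]
    exact hk hk1
  · intro h
    filter_upwards [ae_comp_mul_left (inv_ne_zero h2π) h] with ξ hξ hξ1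
    have e : (2 * Real.pi)⁻¹ * ξ = ξ / (2 * Real.pi) := by rw [div_eq_inv_mul]
    have e2 : 2 * Real.pi * (ξ / (2 * Real.pi)) = ξ := mul_div_cancel₀ _ h2π
    rw [symbolSq_rpow, e, symbolSq, e2] at hξ
    exact hξ hξ1

/-! ### The integrable majorant at low frequency -/

/-- An integrable even function, which after rescaling by `√t` dominates the weights that occur at
low frequency. -/
noncomputable def decayProfile (δ y : ℝ) : ℝ :=
  if |y| ≤ 1 then |y| ^ (2 * δ - 1) else |y| ^ (-4 : ℝ)

theorem decayProfile_nonneg (δ y : ℝ) : 0 ≤ decayProfile δ y := by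
  unfold decayProfile
  split_ifs <;> positivity

theorem decayProfile_neg (δ y : ℝ) : decayProfile δ (-y) = decayProfile δ y := by
  simp [decayProfile]

theorem integrable_decayProfile {δ : ℝ} (hδ : 0 < δ) : Integrable (decayProfile δ) := by
  have h1 : IntegrableOn (decayProfile δ) (Ioc 0 1) := by
    have h := (intervalIntegral.intervalIntegrable_rpow' (a := 0) (b := 1)
      (show -1 < 2 * δ - 1 by linarith)).1
    refine h.congr_fun (fun y hy => ?_) measurableSet_Ioc
    simp only [decayProfile, abs_of_pos hy.1, if_pos hy.2]
  have h2 : IntegrableOn (decayProfile δ) (Ioi 1) := by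
    refine (integrableOn_Ioi_rpow_of_lt (show (-4 : ℝ) < -1 by norm_num) one_pos).congr_fun
      (fun y hy => ?_) measurableSet_Ioi
    have hy' : (1 : ℝ) < y := hy
    simp only [decayProfile, abs_of_pos (one_pos.trans hy'), if_neg hy'.not_ge]
  have h3 : IntegrableOn (decayProfile δ) (Ioi 0) := by
    rw [← Ioc_union_Ioi_eq_Ioi zero_le_one]
    exact h1.union h2
  have h4 : IntegrableOn (decayProfile δ) (Iio 0) := by
    have h := ((Measure.measurePreserving_neg (volume : Measure ℝ)).integrableOn_comp_preimage
      (Homeomorph.neg ℝ).measurableEmbedding (f := decayProfile δ) (s := Ioi 0)).2 h3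
    have e1 : (Neg.neg : ℝ → ℝ) ⁻¹' Ioi 0 = Iio 0 := by ext; simp
    have e2 : decayProfile δ ∘ Neg.neg = decayProfile δ := funext fun y => decayProfile_neg δ y
    rwa [e1, e2] at h
  rw [← integrableOn_univ, ← Iio_union_Ici (a := (0 : ℝ))]
  exact h4.union (Iff.mpr integrableOn_Ici_iff_integrableOn_Ioi h3)

/-- With `y = √x`, the function `min(1, y⁻²)²` times a singular power `|y| ^ (-4β)` is dominated by
the integrable `decayProfile` as soon as `4β ≤ 1 - 2δ`. -/
theorem min_sq_mul_rpow_le_decayProfile {δ β x : ℝ} (hx : 0 < x) (hβ : 0 ≤ β)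
    (hβδ : 4 * β ≤ 1 - 2 * δ) :
    min 1 x⁻¹ ^ 2 * x ^ (-(2 * β)) ≤ decayProfile δ (Real.sqrt x) := by
  have hs : 0 < Real.sqrt x := Real.sqrt_pos.2 hx
  have hxs : x = Real.sqrt x ^ (2 : ℝ) := by
    rw [Real.rpow_two, Real.sq_sqrt hx.le]
  have hsle : Real.sqrt x ≤ 1 ↔ x ≤ 1 := by
    rw [Real.sqrt_le_iff, one_pow]
    exact and_iff_right zero_le_one
  unfold decayProfile
  rw [abs_of_pos hs]
  split_ifs with h
  · have h1 : min 1 x⁻¹ ^ 2 ≤ 1 :=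
      pow_le_one₀ (le_min zero_le_one (by positivity)) (min_le_left _ _)
    calc min 1 x⁻¹ ^ 2 * x ^ (-(2 * β)) ≤ 1 * x ^ (-(2 * β)) := by gcongr
      _ = Real.sqrt x ^ (2 * -(2 * β)) := by
        rw [one_mul, Real.rpow_mul hs.le, ← hxs]
      _ ≤ _ := Real.rpow_le_rpow_of_exponent_ge hs h (by linarith)
  · have hx1 : 1 ≤ x := by
      rw [hsle] at h
      exact (not_le.1 h).le
    have h1 : min 1 x⁻¹ ^ 2 ≤ x⁻¹ ^ 2 := by
      have : 0 ≤ min 1 x⁻¹ := le_min zero_le_one (by positivity)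
      gcongr
      exact min_le_right _ _
    have h2 : x ^ (-(2 * β)) ≤ 1 := Real.rpow_le_one_of_one_le_of_nonpos hx1 (by linarith)
    calc min 1 x⁻¹ ^ 2 * x ^ (-(2 * β)) ≤ x⁻¹ ^ 2 * 1 := by gcongr
      _ = x ^ (-2 : ℝ) := by
        rw [mul_one, inv_pow, Real.rpow_neg hx.le, Real.rpow_two]
      _ = Real.sqrt x ^ (2 * (-2) : ℝ) := by rw [Real.rpow_mul hs.le, ← hxs]
      _ = _ := by norm_num

/-- The weight which governs the convergence of the profiles, with `l = ξ²`: the first factor is the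
rate, the second one bounds the squares of the modes. -/
noncomputable def profileWeight (δ t₀ l t : ℝ) : ℝ :=
  min 1 (l * t)⁻¹ ^ 2 * (1 + (l * t₀) ^ (-δ))

theorem profileWeight_nonneg {δ t₀ l t : ℝ} (hl : 0 ≤ l) (ht₀ : 0 ≤ t₀) :
    0 ≤ profileWeight δ t₀ l t := by
  unfold profileWeight
  have := mul_nonneg hl ht₀
  positivity

/-- The weight remains integrable in `k` against the singularity `ξ^(-4γ)` that the datum may have at
`ξ = 0`, because `γ + δ < 1/4`. -/
theorem profileWeight_mul_rpow_le {δ γ t₀ t l : ℝ} (hδ : 0 < δ) (hγ : 0 ≤ γ)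
    (hγδ : γ + δ < 1 / 4) (ht₀ : 0 < t₀) (ht : t₀ ≤ t) (hl : 0 < l) :
    profileWeight δ t₀ l t * l ^ (-(2 * γ))
      ≤ 2 * (t₀ ^ (-(2 * δ)) * t ^ (2 * (γ + δ))) * decayProfile δ (Real.sqrt (l * t)) := by
  have ht0 : 0 < t := ht₀.trans_le ht
  have hx : 0 < l * t := mul_pos hl ht0
  set x := l * t with hxdef
  set m := min 1 x⁻¹ ^ 2 with hm
  set D := decayProfile δ (Real.sqrt x) with hD
  have hD0 : 0 ≤ D := decayProfile_nonneg _ _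
  have a1 : m * x ^ (-(2 * γ)) ≤ D :=
    min_sq_mul_rpow_le_decayProfile hx hγ (by linarith)
  have a2 : m * x ^ (-(2 * (γ + δ / 2))) ≤ D :=
    min_sq_mul_rpow_le_decayProfile hx (by linarith) (by linarith)
  have hlx : l = x * t⁻¹ := by rw [hxdef]; field_simp
  have e1 : l ^ (-(2 * γ)) = t ^ (2 * γ) * x ^ (-(2 * γ)) := by
    rw [hlx, Real.mul_rpow hx.le (by positivity), Real.inv_rpow ht0.le, ← Real.rpow_neg ht0.le,
      neg_neg, mul_comm]
  have e2 : (l * t₀) ^ (-δ) * l ^ (-(2 * γ))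
      = t₀ ^ (-δ) * t ^ (2 * γ + δ) * x ^ (-(2 * (γ + δ / 2))) := by
    rw [Real.mul_rpow hl.le ht₀.le, mul_right_comm, ← Real.rpow_add hl, hlx,
      Real.mul_rpow hx.le (by positivity), Real.inv_rpow ht0.le, ← Real.rpow_neg ht0.le]
    rw [show -(-δ + -(2 * γ)) = 2 * γ + δ by ring, show -δ + -(2 * γ) = -(2 * (γ + δ / 2)) by ring]
    ring
  have p1 : t ^ (2 * γ) ≤ t₀ ^ (-(2 * δ)) * t ^ (2 * (γ + δ)) := by
    rw [show 2 * (γ + δ) = 2 * γ + 2 * δ by ring, Real.rpow_add ht0, Real.rpow_neg ht₀.le]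
    have h1 : t₀ ^ (2 * δ) ≤ t ^ (2 * δ) := by gcongr
    have h2 : 0 < t₀ ^ (2 * δ) := by positivity
    have h3 : 1 ≤ (t₀ ^ (2 * δ))⁻¹ * t ^ (2 * δ) := by
      rw [← div_eq_inv_mul, one_le_div h2]; exact h1
    calc t ^ (2 * γ) = t ^ (2 * γ) * 1 := (mul_one _).symm
      _ ≤ t ^ (2 * γ) * ((t₀ ^ (2 * δ))⁻¹ * t ^ (2 * δ)) := by gcongr
      _ = _ := by ring
  have p2 : t₀ ^ (-δ) * t ^ (2 * γ + δ) ≤ t₀ ^ (-(2 * δ)) * t ^ (2 * (γ + δ)) := by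
    have e3 : t ^ (2 * (γ + δ)) = t ^ (2 * γ + δ) * t ^ δ := by
      rw [← Real.rpow_add ht0]; congr 1; ring
    rw [e3, show -(2 * δ) = -δ + -δ by ring, Real.rpow_add ht₀]
    have h1 : t₀ ^ δ ≤ t ^ δ := by gcongr
    have h2 : 0 < t₀ ^ δ := by positivity
    have h3 : 1 ≤ t₀ ^ (-δ) * t ^ δ := by
      rw [Real.rpow_neg ht₀.le, ← div_eq_inv_mul, one_le_div h2]; exact h1
    calc t₀ ^ (-δ) * t ^ (2 * γ + δ) = t₀ ^ (-δ) * t ^ (2 * γ + δ) * 1 := (mul_one _).symm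
      _ ≤ t₀ ^ (-δ) * t ^ (2 * γ + δ) * (t₀ ^ (-δ) * t ^ δ) := by gcongr
      _ = _ := by ring
  calc profileWeight δ t₀ l t * l ^ (-(2 * γ))
      = m * (l ^ (-(2 * γ)) + (l * t₀) ^ (-δ) * l ^ (-(2 * γ))) := by
        rw [profileWeight]; ring
    _ = t ^ (2 * γ) * (m * x ^ (-(2 * γ)))
        + t₀ ^ (-δ) * t ^ (2 * γ + δ) * (m * x ^ (-(2 * (γ + δ / 2)))) := by
        rw [e2, e1]; ring
    _ ≤ t₀ ^ (-(2 * δ)) * t ^ (2 * (γ + δ)) * D + t₀ ^ (-(2 * δ)) * t ^ (2 * (γ + δ)) * D := by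
        gcongr
    _ = _ := by ring

/-- Pointwise majorant for the weighted datum: at high frequency the weight is `O(t⁻²)`, at low
frequency the bound on `ξ^{2γ} F` is used. -/
theorem profileWeight_mul_sq_le {δ γ t₀ t k B : ℝ} {z : ℂ} (hδ : 0 < δ) (hγ : 0 ≤ γ)
    (hγδ : γ + δ < 1 / 4) (ht₀ : 1 ≤ t₀) (ht : t₀ ≤ t) (hk : k ≠ 0)
    (hz : symbolSq k ≤ 1 → symbolSq k ^ γ * ‖z‖ ≤ B) :
    profileWeight δ t₀ (symbolSq k) t * ‖z‖ ^ 2 ≤ 2 * (t ^ 2)⁻¹ * ‖z‖ ^ 2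
      + B ^ 2 * (2 * (t₀ ^ (-(2 * δ)) * t ^ (2 * (γ + δ)))
        * decayProfile δ (2 * Real.pi * Real.sqrt t * k)) := by
  have ht₀0 : 0 < t₀ := by linarith
  have ht0 : 0 < t := by linarith
  have hl := symbolSq_pos hk
  set l := symbolSq k with hldef
  have hD : decayProfile δ (2 * Real.pi * Real.sqrt t * k) = decayProfile δ (Real.sqrt (l * t)) := by
    have e : Real.sqrt (l * t) = |2 * Real.pi * Real.sqrt t * k| := by
      rw [hldef, symbolSq, Real.sqrt_mul (sq_nonneg _), Real.sqrt_sq_eq_abs,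
        show 2 * Real.pi * Real.sqrt t * k = 2 * Real.pi * k * Real.sqrt t by ring, abs_mul _ (√t),
        abs_of_nonneg (Real.sqrt_nonneg t)]
    rw [e, decayProfile, decayProfile, abs_abs]
  have hD0 := decayProfile_nonneg δ (2 * Real.pi * Real.sqrt t * k)
  rcases le_total l 1 with h | h
  · have h1 := hz h
    have h2 : ‖z‖ ^ 2 ≤ B ^ 2 * l ^ (-(2 * γ)) := by
      have e : ‖z‖ = (l ^ γ * ‖z‖) * l ^ (-γ) := by
        rw [mul_right_comm, ← Real.rpow_add hl, add_neg_cancel, Real.rpow_zero, one_mul]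
      have e' : l ^ (-(2 * γ)) = (l ^ (-γ)) ^ 2 := by
        rw [← Real.rpow_natCast, ← Real.rpow_mul hl.le]; congr 1; push_cast; ring
      rw [e, mul_pow, e']
      gcongr
    have h3 := profileWeight_mul_rpow_le hδ hγ hγδ ht₀0 ht hl
    rw [← hD] at h3
    have h4 : 0 ≤ 2 * (t ^ 2)⁻¹ * ‖z‖ ^ 2 := by positivity
    calc profileWeight δ t₀ l t * ‖z‖ ^ 2
        ≤ profileWeight δ t₀ l t * (B ^ 2 * l ^ (-(2 * γ))) :=
          mul_le_mul_of_nonneg_left h2 (profileWeight_nonneg hl.le ht₀0.le)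
      _ = B ^ 2 * (profileWeight δ t₀ l t * l ^ (-(2 * γ))) := by ring
      _ ≤ B ^ 2 * (2 * (t₀ ^ (-(2 * δ)) * t ^ (2 * (γ + δ)))
        * decayProfile δ (2 * Real.pi * Real.sqrt t * k)) := by gcongr
      _ ≤ _ := by linarith
  · have h1 : profileWeight δ t₀ l t ≤ 2 * (t ^ 2)⁻¹ := by
      have m0 : 0 ≤ min 1 (l * t)⁻¹ := le_min zero_le_one (by positivity)
      have m1 : min 1 (l * t)⁻¹ ≤ t⁻¹ := by
        refine (min_le_right _ _).trans ?_
        gcongr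
        nlinarith
      have m2 : (l * t₀) ^ (-δ) ≤ 1 :=
        Real.rpow_le_one_of_one_le_of_nonpos (by nlinarith) (by linarith)
      calc profileWeight δ t₀ l t ≤ t⁻¹ ^ 2 * (1 + 1) := by
            unfold profileWeight; gcongr
        _ = _ := by rw [inv_pow]; ring
    have h2 : 0 ≤ B ^ 2 * (2 * (t₀ ^ (-(2 * δ)) * t ^ (2 * (γ + δ)))
        * decayProfile δ (2 * Real.pi * Real.sqrt t * k)) := by positivity
    have h3 : profileWeight δ t₀ l t * ‖z‖ ^ 2 ≤ 2 * (t ^ 2)⁻¹ * ‖z‖ ^ 2 := by gcongr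
    linarith

/-! ### Scattering -/

/-- The profile of the solution on the Fourier side: the free flow from `t₀` to `t` is undone. -/
noncomputable def modeProfile (κ t₀ : ℝ) (F : L2) (t : ℝ) : L2 :=
  mulL2 (fun k => freePhase (symbolSq k) (t - t₀)) (modeSolution κ t₀ F t)

theorem continuous_freePhase_symbolSq (τ : ℝ) : Continuous fun k => freePhase (symbolSq k) τ := by
  unfold freePhase symbolSq
  fun_prop

theorem coeFn_mulL2_freePhase (τ : ℝ) (g : L2) :
    mulL2 (fun k => freePhase (symbolSq k) τ) g =ᵐ[volume] fun k => freePhase (symbolSq k) τ * g k :=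
  coeFn_mulL2 (continuous_freePhase_symbolSq τ).aestronglyMeasurable
    (Eventually.of_forall fun _ => (norm_freePhase _ _).le) g

theorem norm_mulL2_freePhase (τ : ℝ) (g : L2) :
    ‖mulL2 (fun k => freePhase (symbolSq k) τ) g‖ = ‖g‖ := by
  have h : ∀ᵐ k, ‖mulL2 (fun k => freePhase (symbolSq k) τ) g k‖ = ‖g k‖ := by
    filter_upwards [coeFn_mulL2_freePhase τ g] with k hk
    rw [hk, norm_mul, norm_freePhase, one_mul]
  exact le_antisymm (Lp.norm_le_norm_of_ae_le (h.mono fun _ hk => hk.le))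
    (Lp.norm_le_norm_of_ae_le (h.mono fun _ hk => hk.ge))

theorem norm_sub_freeSchrodinger (τ : ℝ) (u w : L2) :
    ‖u - freeSchrodinger τ w‖
      = ‖mulL2 (fun k => freePhase (symbolSq k) τ) (𝓕 u : L2) - (𝓕 w : L2)‖ := by
  have hF : (𝓕 (u - freeSchrodinger τ w) : L2) = 𝓕 u - (𝓕 (freeSchrodinger τ w) : L2) :=
    map_sub (Lp.fourierTransformₗᵢ ℝ ℂ) _ _
  rw [← Lp.norm_fourier_eq (u - freeSchrodinger τ w), hF, freeSchrodinger,
    FourierTransform.fourier_fourierInv_eq]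
  set S : L2 := (memLp_schrodinger_phase τ (𝓕 w : L2)).toLp _ with hS
  have h : ∀ᵐ k, ‖((𝓕 u : L2) - S) k‖
      = ‖(mulL2 (fun k => freePhase (symbolSq k) τ) (𝓕 u : L2) - (𝓕 w : L2)) k‖ := by
    filter_upwards [Lp.coeFn_sub (𝓕 u : L2) S, coeFn_mulL2_freePhase τ (𝓕 u : L2),
      Lp.coeFn_sub (mulL2 (fun k => freePhase (symbolSq k) τ) (𝓕 u : L2)) (𝓕 w : L2),
      (memLp_schrodinger_phase τ (𝓕 w : L2)).coeFn_toLp] with k h1 h2 h3 h4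
    rw [h1, h3, Pi.sub_apply, Pi.sub_apply, h2, hS, h4]
    have e : freePhase (symbolSq k) τ *
        Complex.exp (((-(τ * (2 * Real.pi * k) ^ 2) : ℝ) : ℂ) * Complex.I) = 1 := by
      rw [freePhase, ← Complex.exp_add, ← Complex.exp_zero, symbolSq]
      congr 1
      push_cast
      ring
    rw [← one_mul ‖_ - _‖, ← norm_freePhase (symbolSq k) τ, ← norm_mul, mul_sub, ← mul_assoc, e,
      one_mul]
  exact le_antisymm (Lp.norm_le_norm_of_ae_le (h.mono fun _ hk => hk.le))
    (Lp.norm_le_norm_of_ae_le (h.mono fun _ hk => hk.ge))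

/-- The powers of `t₀` and `t` in the high- and in the low-frequency contribution are both
dominated by the rate of convergence. -/
theorem rate_bounds {γ δ t₀ t : ℝ} (hγδ : 0 ≤ γ + δ) (hγδ' : γ + δ < 1 / 4) (ht₀ : 1 ≤ t₀)
    (ht : t₀ ≤ t) :
    (t ^ 2)⁻¹ * (t₀ ^ (1 / 4 : ℝ)) ^ 2 ≤ (t₀ ^ (1 / 2 - (γ + δ)) / t ^ (1 / 4 - (γ + δ))) ^ 2 ∧
      (t₀ ^ (1 / 2 - γ)) ^ 2 * ((t₀ ^ (-(2 * δ)) * t ^ (2 * (γ + δ))) * (2 * Real.pi * √t)⁻¹)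
        ≤ (t₀ ^ (1 / 2 - (γ + δ)) / t ^ (1 / 4 - (γ + δ))) ^ 2 := by
  have ht₀0 : 0 < t₀ := by linarith
  have ht0 : 0 < t := by linarith
  have hsq : ∀ {x : ℝ} (y : ℝ), 0 < x → (x ^ y) ^ 2 = x ^ (2 * y) := fun {x} y hx => by
    rw [← Real.rpow_natCast, ← Real.rpow_mul hx.le]; congr 1; push_cast; ring
  have eR : (t₀ ^ (1 / 2 - (γ + δ)) / t ^ (1 / 4 - (γ + δ))) ^ 2
      = t ^ (-(2 * (1 / 4 - (γ + δ)))) * t₀ ^ (2 * (1 / 2 - (γ + δ))) := by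
    rw [div_pow, hsq _ ht₀0, hsq _ ht0, Real.rpow_neg ht0.le, div_eq_inv_mul]
  rw [eR]
  constructor
  · rw [hsq _ ht₀0, ← Real.rpow_two, ← Real.rpow_neg ht0.le]
    gcongr
    · linarith
    · linarith
    · linarith
  · have e1 : (t₀ ^ (1 / 2 - γ)) ^ 2 * t₀ ^ (-(2 * δ)) = t₀ ^ (2 * (1 / 2 - (γ + δ))) := by
      rw [hsq _ ht₀0, ← Real.rpow_add ht₀0]; congr 1; ring
    have e2 : t ^ (2 * (γ + δ)) * (√t)⁻¹ = t ^ (-(2 * (1 / 4 - (γ + δ)))) := by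
      rw [Real.sqrt_eq_rpow, ← Real.rpow_neg ht0.le, ← Real.rpow_add ht0]; congr 1; ring
    have e3 : (2 * Real.pi)⁻¹ ≤ 1 := inv_le_one_of_one_le₀ (by linarith [Real.pi_gt_three])
    have e4 : 0 ≤ t ^ (-(2 * (1 / 4 - (γ + δ)))) * t₀ ^ (2 * (1 / 2 - (γ + δ))) := by positivity
    calc _ = (2 * Real.pi)⁻¹ * ((t ^ (2 * (γ + δ)) * (√t)⁻¹)
          * ((t₀ ^ (1 / 2 - γ)) ^ 2 * t₀ ^ (-(2 * δ)))) := by rw [mul_inv]; ring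
      _ ≤ _ := by rw [e1, e2]; exact mul_le_of_le_one_left e4 e3

/-- The profile converges in `L²`, with the claimed rate. -/
theorem exists_norm_modeProfile_sub_le {c δ : ℝ} (hc : 0 ≤ c) (hδ : 0 < δ) (hδ1 : δ < 1 / 4) :
    ∃ C : ℝ, 0 ≤ C ∧ ∀ {κ γ t₀ N : ℝ} {F : L2}, |κ| ≤ c → 0 ≤ γ → γ + δ < 1 / 4 → 1 ≤ t₀ → 0 ≤ N →
      ‖F‖ ≤ t₀ ^ (1 / 4 : ℝ) * N →
      (∀ᵐ k : ℝ, symbolSq k ≤ 1 → symbolSq k ^ γ * ‖F k‖ ≤ t₀ ^ (1 / 2 - γ) * N) →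
      ∀ {t t' : ℝ}, t₀ ≤ t → t ≤ t' → ‖modeProfile κ t₀ F t' - modeProfile κ t₀ F t‖
        ≤ C * (t₀ ^ (1 / 2 - (γ + δ)) / t ^ (1 / 4 - (γ + δ))) * N := by
  obtain ⟨K, hK, hprof⟩ := exists_norm_profile_sub_le hc (ε := δ / 2) (by linarith) (by linarith)
  set J : ℝ := ∫ y, decayProfile δ y with hJ
  have hJ0 : 0 ≤ J := integral_nonneg fun y => decayProfile_nonneg δ y
  refine ⟨Real.sqrt (8 * K * (1 + J)), Real.sqrt_nonneg _,
    fun {κ γ t₀ N F} hκ hγ hγδ ht₀ hN hFN hlow {t t'} ht htt => ?_⟩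
  have ht₀0 : 0 < t₀ := by linarith
  have ht0 : 0 < t := by linarith
  set G := reflConj F with hG
  set B := t₀ ^ (1 / 2 - γ) * N with hB
  set Θ := t₀ ^ (-(2 * δ)) * t ^ (2 * (γ + δ)) with hΘ
  set R := t₀ ^ (1 / 2 - (γ + δ)) / t ^ (1 / 4 - (γ + δ)) with hR
  set b := 2 * Real.pi * √t with hb
  have hb0 : 0 < b := by positivity
  have hR0 : 0 ≤ R := by positivity
  -- The bound on `ξ^{2γ} F` is inherited by the reflected conjugate of `F`.
  have hlowG : ∀ᵐ k : ℝ, symbolSq k ≤ 1 → symbolSq k ^ γ * ‖G k‖ ≤ B := by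
    filter_upwards [ae_neg_of_ae hlow, coeFn_reflConj F] with k h1 h2
    rw [hG, h2, RCLike.norm_conj]
    rwa [symbolSq_neg] at h1
  set major : ℝ → ℝ := fun k => 2 * K * ((2 * (t ^ 2)⁻¹ * ‖F k‖ ^ 2
      + B ^ 2 * (2 * Θ * decayProfile δ (b * k)))
    + (2 * (t ^ 2)⁻¹ * ‖G k‖ ^ 2 + B ^ 2 * (2 * Θ * decayProfile δ (b * k)))) with hmajor
  have hDint : Integrable fun k => B ^ 2 * (2 * Θ * decayProfile δ (b * k)) :=
    (((integrable_decayProfile hδ).comp_mul_left' hb0.ne').const_mul _).const_mul _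
  have hsqint : ∀ g : L2, Integrable fun k => 2 * (t ^ 2)⁻¹ * ‖g k‖ ^ 2 := fun g =>
    ((Lp.memLp g).integrable_norm_pow two_ne_zero).const_mul _
  have hpoint : ∀ᵐ k, ‖(modeProfile κ t₀ F t' - modeProfile κ t₀ F t) k‖ ^ 2 ≤ major k := by
    filter_upwards [Lp.coeFn_sub (modeProfile κ t₀ F t') (modeProfile κ t₀ F t),
      coeFn_mulL2_freePhase (t' - t₀) (modeSolution κ t₀ F t'),
      coeFn_mulL2_freePhase (t - t₀) (modeSolution κ t₀ F t),
      coeFn_modeSolution (κ := κ) ht₀0 F (ht.trans htt), coeFn_modeSolution (κ := κ) ht₀0 F ht,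
      ae_ne_zero, hlow, hlowG] with k h1 h2 h3 h4 h5 hk h6 h7
    obtain ⟨p1, p2⟩ := hprof hκ ht₀0 (symbolSq_pos hk) ht htt
    rw [show -(2 * (δ / 2)) = -δ by ring] at p1 p2
    change _ ≤ K * profileWeight δ t₀ (symbolSq k) t at p1
    change _ ≤ K * profileWeight δ t₀ (symbolSq k) t at p2
    have q1 := profileWeight_mul_sq_le hδ hγ hγδ ht₀ ht hk h6
    have q2 := profileWeight_mul_sq_le hδ hγ hγδ ht₀ ht hk h7
    rw [← hΘ, ← hb] at q1 q2
    have e : (modeProfile κ t₀ F t' - modeProfile κ t₀ F t) k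
        = (freePhase (symbolSq k) (t' - t₀) * modeDirect κ t₀ (symbolSq k) t'
            - freePhase (symbolSq k) (t - t₀) * modeDirect κ t₀ (symbolSq k) t) * F k
          + (freePhase (symbolSq k) (t' - t₀) * modeConj κ t₀ (symbolSq k) t'
            - freePhase (symbolSq k) (t - t₀) * modeConj κ t₀ (symbolSq k) t) * G k := by
      rw [h1, Pi.sub_apply, modeProfile, modeProfile, h2, h3, h4, h5]
      ring
    rw [e]
    set x := freePhase (symbolSq k) (t' - t₀) * modeDirect κ t₀ (symbolSq k) t'
            - freePhase (symbolSq k) (t - t₀) * modeDirect κ t₀ (symbolSq k) t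
    set y := freePhase (symbolSq k) (t' - t₀) * modeConj κ t₀ (symbolSq k) t'
            - freePhase (symbolSq k) (t - t₀) * modeConj κ t₀ (symbolSq k) t
    have n1 : ‖x * F k + y * G k‖ ^ 2 ≤ 2 * (‖x‖ ^ 2 * ‖F k‖ ^ 2 + ‖y‖ ^ 2 * ‖G k‖ ^ 2) := by
      have := norm_add_le (x * F k) (y * G k)
      rw [norm_mul, norm_mul] at this
      calc ‖x * F k + y * G k‖ ^ 2 ≤ (‖x‖ * ‖F k‖ + ‖y‖ * ‖G k‖) ^ 2 := by gcongr
        _ ≤ _ := by nlinarith [sq_nonneg (‖x‖ * ‖F k‖ - ‖y‖ * ‖G k‖)]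
    have n2 : ‖x‖ ^ 2 * ‖F k‖ ^ 2 ≤ K * (profileWeight δ t₀ (symbolSq k) t * ‖F k‖ ^ 2) := by
      rw [← mul_assoc]; gcongr
    have n3 : ‖y‖ ^ 2 * ‖G k‖ ^ 2 ≤ K * (profileWeight δ t₀ (symbolSq k) t * ‖G k‖ ^ 2) := by
      rw [← mul_assoc]; gcongr
    have n4 := mul_le_mul_of_nonneg_left q1 hK.le
    have n5 := mul_le_mul_of_nonneg_left q2 hK.le
    rw [hmajor]
    simp only
    linarith
  have hmajint : Integrable major :=
    (((hsqint F).add hDint).add ((hsqint G).add hDint)).const_mul _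
  have hD : ∫ k, decayProfile δ (b * k) = b⁻¹ * J := by
    rw [Measure.integral_comp_mul_left, abs_of_pos (inv_pos.2 hb0), smul_eq_mul]
  have hval : ∫ k, major k = 8 * K * ((t ^ 2)⁻¹ * ‖F‖ ^ 2 + B ^ 2 * (Θ * b⁻¹) * J) := by
    have hint : ∀ g : L2, Integrable fun k => 2 * (t ^ 2)⁻¹ * ‖g k‖ ^ 2
        + B ^ 2 * (2 * Θ * decayProfile δ (b * k)) := fun g => (hsqint g).add hDint
    rw [hmajor, integral_const_mul, integral_add (hint F) (hint G),
      integral_add (hsqint F) hDint, integral_add (hsqint G) hDint]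
    simp only [integral_const_mul]
    rw [hD, ← norm_sq_eq_integral, ← norm_sq_eq_integral, hG, norm_reflConj]
    ring
  have hle : ‖modeProfile κ t₀ F t' - modeProfile κ t₀ F t‖ ^ 2 ≤ ∫ k, major k := by
    rw [norm_sq_eq_integral]
    exact integral_mono_of_nonneg (Eventually.of_forall fun k => sq_nonneg _) hmajint hpoint
  obtain ⟨r1, r2⟩ := rate_bounds (γ := γ) (δ := δ) (by linarith) hγδ ht₀ ht
  rw [← hR, ← hΘ, ← hb] at r2
  rw [← hR] at r1
  have s1 : (t ^ 2)⁻¹ * ‖F‖ ^ 2 ≤ R ^ 2 * N ^ 2 := by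
    calc (t ^ 2)⁻¹ * ‖F‖ ^ 2 ≤ (t ^ 2)⁻¹ * (t₀ ^ (1 / 4 : ℝ) * N) ^ 2 := by gcongr
      _ = (t ^ 2)⁻¹ * (t₀ ^ (1 / 4 : ℝ)) ^ 2 * N ^ 2 := by ring
      _ ≤ _ := by gcongr
  have s2 : B ^ 2 * (Θ * b⁻¹) * J ≤ R ^ 2 * N ^ 2 * J := by
    calc B ^ 2 * (Θ * b⁻¹) * J = (t₀ ^ (1 / 2 - γ)) ^ 2 * (Θ * b⁻¹) * N ^ 2 * J := by
          rw [hB]; ring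
      _ ≤ _ := by gcongr
  refine le_of_sq_le_sq ?_ (by positivity)
  calc _ ≤ 8 * K * ((t ^ 2)⁻¹ * ‖F‖ ^ 2 + B ^ 2 * (Θ * b⁻¹) * J) := hle.trans_eq hval
    _ ≤ 8 * K * (R ^ 2 * N ^ 2 + R ^ 2 * N ^ 2 * J) := by gcongr
    _ = 8 * K * (1 + J) * (R * N) ^ 2 := by ring
    _ = (√(8 * K * (1 + J)) * R * N) ^ 2 := by
      rw [mul_assoc (√_) R N, mul_pow (√_), Real.sq_sqrt (by positivity)]

/-! ### The norms of the data and of the solution -/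

/-- The two bounds on the Fourier transform of the datum contained in the norm of `X_{t₀}^γ`. -/
theorem bounds_of_normX_lt_top {γ t₀ : ℝ} (ht₀ : 0 < t₀) {f : L2} (hf : normX γ t₀ f < ∞) :
    ‖(𝓕 f : L2)‖ ≤ t₀ ^ (1 / 4 : ℝ) * (normX γ t₀ f).toReal ∧
      ∀ᵐ k : ℝ, symbolSq k ≤ 1 →
        symbolSq k ^ γ * ‖(𝓕 f : L2) k‖ ≤ t₀ ^ (1 / 2 - γ) * (normX γ t₀ f).toReal := by
  have hw : 0 < t₀ ^ γ / √t₀ := by positivity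
  have hle : ENNReal.ofReal (t₀ ^ γ / √t₀) * lowFreqNorm γ f < ∞ :=
    lt_of_le_of_lt le_add_self hf
  have hlow : lowFreqNorm γ f ≠ ∞ := fun h => by
    rw [h, ENNReal.mul_top (ENNReal.ofReal_pos.2 hw).ne'] at hle
    exact lt_irrefl _ hle
  have hN : (normX γ t₀ f).toReal
      = 1 / t₀ ^ (1 / 4 : ℝ) * ‖f‖ + t₀ ^ γ / √t₀ * (lowFreqNorm γ f).toReal := by
    rw [normX, ENNReal.toReal_add ENNReal.ofReal_ne_top hle.ne, ENNReal.toReal_mul,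
      ENNReal.toReal_ofReal (by positivity), ENNReal.toReal_ofReal hw.le]
  have hN0 : 0 ≤ (normX γ t₀ f).toReal := ENNReal.toReal_nonneg
  have hl0 : 0 ≤ (lowFreqNorm γ f).toReal := ENNReal.toReal_nonneg
  constructor
  · rw [Lp.norm_fourier_eq]
    have h1 : 1 / t₀ ^ (1 / 4 : ℝ) * ‖f‖ ≤ (normX γ t₀ f).toReal := by
      rw [hN]; exact le_add_of_nonneg_right (by positivity)
    rwa [one_div, inv_mul_le_iff₀ (by positivity)] at h1
  · refine (lowFreqNorm_le_ofReal_iff (by positivity)).1 ?_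
    rw [← ENNReal.ofReal_toReal hlow]
    refine ENNReal.ofReal_le_ofReal ?_
    have h1 : t₀ ^ γ / √t₀ * (lowFreqNorm γ f).toReal ≤ (normX γ t₀ f).toReal := by
      rw [hN]; exact le_add_of_nonneg_left (by positivity)
    have h2 : t₀ ^ (1 / 2 - γ) * (t₀ ^ γ / √t₀) = 1 := by
      rw [Real.sqrt_eq_rpow, mul_div_assoc', ← Real.rpow_add ht₀, sub_add_cancel,
        div_self (by positivity)]
    calc (lowFreqNorm γ f).toReal
        = t₀ ^ (1 / 2 - γ) * (t₀ ^ γ / √t₀ * (lowFreqNorm γ f).toReal) := by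
          rw [← mul_assoc, h2, one_mul]
      _ ≤ _ := by gcongr

/-- At low frequencies the solution grows at most like `(t / t₀)^|κ|`, because the modes do. -/
theorem lowFreqNorm_le_of_fourier_eq {κ γ t₀ B t : ℝ} (hB : 0 ≤ B) (ht₀ : 0 < t₀) (ht : t₀ ≤ t)
    {F g : L2} (hF : ∀ᵐ k : ℝ, symbolSq k ≤ 1 → symbolSq k ^ γ * ‖F k‖ ≤ B)
    (hg : (𝓕 g : L2) = modeSolution κ t₀ F t) :
    lowFreqNorm γ g ≤ ENNReal.ofReal ((t / t₀) ^ |κ| * (2 * B)) := by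
  have ht0 : 0 < t := ht₀.trans_le ht
  rw [lowFreqNorm_le_ofReal_iff (by positivity), hg]
  filter_upwards [coeFn_modeSolution (κ := κ) ht₀ F ht, hF, ae_neg_of_ae hF, coeFn_reflConj F,
    ae_ne_zero] with k h1 h2 h3 h4 hk hk1
  obtain ⟨m1, m2⟩ := norm_mode_le_of_le (κ := κ) ht₀ ht le_rfl hk
  rw [symbolSq_neg] at h3
  have h5 : symbolSq k ^ γ * ‖reflConj F k‖ ≤ B := by
    rw [h4, RCLike.norm_conj]
    exact h3 hk1
  have hs : 0 ≤ symbolSq k ^ γ := Real.rpow_nonneg (symbolSq_pos hk).le _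
  have hM : 0 ≤ (t / t₀) ^ |κ| := by positivity
  rw [h1]
  calc _ ≤ symbolSq k ^ γ * ((t / t₀) ^ |κ| * ‖F k‖ + (t / t₀) ^ |κ| * ‖reflConj F k‖) := by
        refine mul_le_mul_of_nonneg_left ((norm_add_le _ _).trans ?_) hs
        rw [norm_mul, norm_mul]
        gcongr
    _ = (t / t₀) ^ |κ| * (symbolSq k ^ γ * ‖F k‖ + symbolSq k ^ γ * ‖reflConj F k‖) := by ring
    _ ≤ _ := by
        refine mul_le_mul_of_nonneg_left ?_ hM
        linarith [h2 hk1]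

/-- The weight `(t₀ / t)^{a²}` in the norm of `Y_{t₀}^γ` absorbs the growth of the low
frequencies. -/
theorem normY_lt_top {a γ t₀ M B : ℝ} (ht₀ : 0 < t₀) {u : ℝ → L2}
    (hM : ∀ t, t₀ ≤ t → ‖u t‖ ≤ M)
    (hB : ∀ t, t₀ ≤ t → lowFreqNorm γ (u t) ≤ ENNReal.ofReal ((t / t₀) ^ (a ^ 2) * B)) :
    normY a γ t₀ u < ∞ := by
  refine lt_of_le_of_lt (b := ENNReal.ofReal (1 / t₀ ^ (1 / 4 : ℝ) * M)
    + ENNReal.ofReal (t₀ ^ γ / √t₀ * B)) ?_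
    (ENNReal.add_lt_top.2 ⟨ENNReal.ofReal_lt_top, ENNReal.ofReal_lt_top⟩)
  refine iSup₂_le fun t ht => add_le_add (ENNReal.ofReal_le_ofReal ?_) ?_
  · have := hM t ht
    gcongr
  · have ht0 : 0 < t := ht₀.trans_le ht
    refine (mul_le_mul_right (hB t ht) _).trans ?_
    rw [← ENNReal.ofReal_mul (by positivity)]
    refine ENNReal.ofReal_le_ofReal (le_of_eq ?_)
    have h : (t₀ / t) ^ (a ^ 2) * (t / t₀) ^ (a ^ 2) = 1 := by
      rw [← Real.mul_rpow (by positivity) (by positivity), div_mul_div_cancel₀ ht0.ne',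
        div_self ht₀.ne', Real.one_rpow]
    linear_combination (t₀ ^ γ / √t₀ * B) * h

/-! ### Existence, uniqueness and scattering -/

theorem tendsto_rate {p q : ℝ} (hq : 0 < q) (C t₀ N : ℝ) :
    Tendsto (fun t : ℝ => C * (t₀ ^ p / t ^ q) * N) atTop (𝓝 0) := by
  have h : Tendsto (fun t : ℝ => t₀ ^ p / t ^ q) atTop (𝓝 0) :=
    (tendsto_rpow_atTop hq).const_div_atTop _
  simpa using (h.const_mul C).mul_const N

theorem proposition2p4 :
    ∃ C : ℝ → ℝ → ℝ, ∀ σ a γ t₀ : ℝ, (σ = 1 ∨ σ = -1) → 0 < a → 0 ≤ γ → γ < 1 / 4 → 1 ≤ t₀ →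
      ∀ f : L2, normX γ t₀ f < ∞ →
        ∃ u : ℝ → L2, IsGlobalSolutionY σ a γ t₀ f u ∧
          (∀ v : ℝ → L2, IsGlobalSolutionY σ a γ t₀ f v → EqOn v u (Ici t₀)) ∧
          ∃ uPlus : L2,
            (∀ δ : ℝ, 0 < δ → δ < 1 / 4 - γ → ∀ t : ℝ, t₀ ≤ t →
              ‖u t - freeSchrodinger (t - t₀) uPlus‖ ≤
                C a δ * ((1 + Real.log t₀) * t₀ ^ (1 / 2 - (γ + δ)) / t ^ (1 / 4 - (γ + δ)))
                  * (normX γ t₀ f).toReal) ∧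
            Tendsto (fun t : ℝ => ‖u t - freeSchrodinger (t - t₀) uPlus‖) atTop (𝓝 0) := by
  have hconst : ∀ a δ : ℝ, ∃ C : ℝ, 0 < δ → δ < 1 / 4 → 0 ≤ C ∧
      ∀ {κ γ t₀ N : ℝ} {F : L2}, |κ| ≤ a ^ 2 → 0 ≤ γ → γ + δ < 1 / 4 → 1 ≤ t₀ → 0 ≤ N →
      ‖F‖ ≤ t₀ ^ (1 / 4 : ℝ) * N →
      (∀ᵐ k : ℝ, symbolSq k ≤ 1 → symbolSq k ^ γ * ‖F k‖ ≤ t₀ ^ (1 / 2 - γ) * N) →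
      ∀ {t t' : ℝ}, t₀ ≤ t → t ≤ t' → ‖modeProfile κ t₀ F t' - modeProfile κ t₀ F t‖
        ≤ C * (t₀ ^ (1 / 2 - (γ + δ)) / t ^ (1 / 4 - (γ + δ))) * N := by
    intro a δ
    by_cases h : 0 < δ ∧ δ < 1 / 4
    · obtain ⟨C, h0, h1⟩ := exists_norm_modeProfile_sub_le (sq_nonneg a) h.1 h.2
      exact ⟨C, fun _ _ => ⟨h0, h1⟩⟩
    · exact ⟨0, fun h1 h2 => absurd ⟨h1, h2⟩ h⟩
  choose C hC using hconst
  refine ⟨C, fun σ a γ t₀ hσ _ hγ hγ4 ht₀ f hf => ?_⟩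
  have ht₀0 : 0 < t₀ := by linarith
  set κ := σ * a ^ 2 with hκ
  have hκabs : |κ| = a ^ 2 := by
    rw [hκ, abs_mul, abs_of_nonneg (sq_nonneg a)]
    rcases hσ with h | h <;> simp [h]
  set N := (normX γ t₀ f).toReal with hN
  have hN0 : 0 ≤ N := ENNReal.toReal_nonneg
  set F : L2 := 𝓕 f with hF
  obtain ⟨hFN, hlow⟩ := bounds_of_normX_lt_top ht₀0 hf
  rw [← hN, ← hF] at hFN hlow
  have hdiff : ∀ {δ : ℝ}, 0 < δ → δ < 1 / 4 - γ → ∀ {t t' : ℝ}, t₀ ≤ t → t ≤ t' →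
      ‖modeProfile κ t₀ F t' - modeProfile κ t₀ F t‖
        ≤ C a δ * (t₀ ^ (1 / 2 - (γ + δ)) / t ^ (1 / 4 - (γ + δ))) * N :=
    fun {δ} h1 h2 {t t'} ht htt => (hC a δ h1 (by linarith)).2 hκabs.le hγ (by linarith) ht₀ hN0
      hFN hlow ht htt
  -- An admissible exponent, used wherever the value of the rate is immaterial.
  obtain ⟨ε, hε0, hε⟩ : ∃ ε : ℝ, 0 < ε ∧ ε < 1 / 4 - γ := exists_between (by linarith)
  have hrate : Tendsto (fun t : ℝ =>
      C a ε * (t₀ ^ (1 / 2 - (γ + ε)) / t ^ (1 / 4 - (γ + ε))) * N) atTop (𝓝 0) :=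
    tendsto_rate (by linarith) _ _ _
  obtain ⟨w, hw⟩ : ∃ w : L2, Tendsto (modeProfile κ t₀ F) atTop (𝓝 w) := by
    refine cauchy_map_iff_exists_tendsto.1 (Metric.cauchy_iff.2 ⟨inferInstance, fun η hη => ?_⟩)
    obtain ⟨T, hT, hT₀⟩ := ((hrate.eventually (gt_mem_nhds (half_pos hη))).and
      (eventually_ge_atTop t₀)).exists
    refine ⟨modeProfile κ t₀ F '' Ici T, image_mem_map (Ici_mem_atTop T), ?_⟩
    rintro _ ⟨s, hs, rfl⟩ _ ⟨s', hs', rfl⟩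
    have d1 := (hdiff hε0 hε hT₀ hs).trans_lt hT
    have d2 := (hdiff hε0 hε hT₀ hs').trans_lt hT
    rw [← dist_eq_norm] at d1 d2
    linarith [dist_triangle_right (modeProfile κ t₀ F s) (modeProfile κ t₀ F s')
      (modeProfile κ t₀ F T)]
  set u : ℝ → L2 := fun t => 𝓕⁻ (modeSolution κ t₀ F t) with hu
  have hFu : ∀ t, (𝓕 (u t) : L2) = modeSolution κ t₀ F t := fun t =>
    FourierTransform.fourier_fourierInv_eq _
  have hsol : IsLinSolution σ a t₀ u := by
    rw [isLinSolution_iff ht₀0]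
    simp only [hFu]
    exact isFourierSolution_modeSolution ht₀0 F
  have hinit : u t₀ = f := by
    rw [hu]
    simp only
    rw [modeSolution_self ht₀0, hF, FourierTransform.fourierInv_fourier_eq]
  have hnorm : ∀ t, ‖u t‖ = ‖modeProfile κ t₀ F t‖ := fun t => by
    rw [modeProfile, norm_mulL2_freePhase, ← hFu, Lp.norm_fourier_eq]
  have hscat : ∀ t, ‖u t - freeSchrodinger (t - t₀) (𝓕⁻ w)‖ = ‖w - modeProfile κ t₀ F t‖ :=
    fun t => by
      rw [norm_sub_freeSchrodinger, hFu, FourierTransform.fourier_fourierInv_eq, norm_sub_rev]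
      rfl
  have hlim : ∀ {δ : ℝ}, 0 < δ → δ < 1 / 4 - γ → ∀ {t : ℝ}, t₀ ≤ t →
      ‖u t - freeSchrodinger (t - t₀) (𝓕⁻ w)‖
        ≤ C a δ * (t₀ ^ (1 / 2 - (γ + δ)) / t ^ (1 / 4 - (γ + δ))) * N :=
    fun {δ} h1 h2 {t} ht => by
      rw [hscat]
      exact le_of_tendsto (hw.sub_const _).norm
        ((eventually_ge_atTop t).mono fun t' htt => hdiff h1 h2 ht htt)
  refine ⟨u, ⟨hsol, hinit, ?_⟩,
    fun v hv => hv.solution.eqOn ht₀0 hsol (hv.initial.trans hinit.symm), 𝓕⁻ w, ?_, ?_⟩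
  · refine normY_lt_top ht₀0 (B := 2 * (t₀ ^ (1 / 2 - γ) * N))
      (M := ‖modeProfile κ t₀ F t₀‖
        + C a ε * (t₀ ^ (1 / 2 - (γ + ε)) / t₀ ^ (1 / 4 - (γ + ε))) * N)
      (fun t ht => ?_) fun t ht => ?_
    · rw [hnorm]
      refine (norm_le_norm_add_norm_sub' _ (modeProfile κ t₀ F t₀)).trans ?_
      gcongr
      exact hdiff hε0 hε le_rfl ht
    · rw [← hκabs]
      exact lowFreqNorm_le_of_fourier_eq (by positivity) ht₀0 ht hlow (hFu t)
  · intro δ h1 h2 t ht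
    have hC0 := (hC a δ h1 (by linarith)).1
    have ht0 : 0 < t := ht₀0.trans_le ht
    refine (hlim h1 h2 ht).trans ?_
    -- The argument loses no logarithm.
    have hlog : 1 ≤ 1 + Real.log t₀ := le_add_of_nonneg_right (Real.log_nonneg ht₀)
    have hpow : 0 ≤ t₀ ^ (1 / 2 - (γ + δ)) := by positivity
    gcongr
    exact le_mul_of_one_le_left hpow hlog
  · exact squeeze_zero' (Eventually.of_forall fun t => norm_nonneg _)
      ((eventually_ge_atTop t₀).mono fun t ht => hlim hε0 hε ht) hrate
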